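/- Let $\mu$ be a Borel probability measure on $\mathbb{R}$ and let $T>0$, $\epsilon>0$. Let $L_2(T)$ be the space of complex square integrable functions with respect to the uniform probability measure on $[0,T]$, with $\langle a,b\rangle_T=\frac1T\int_0^T \overline{a(t)}\,b(t)\,dt$. Define $\mathcal F_\mu : L_2(T)\to L_2(\mu)$ by $[\mathcal F_\mu f](\xi)=\frac1T\int_0^T f(t)e^{-2\pi i t\xi}\,dt$, and let $\mathcal K_\mu=\mathcal F_\mu^*\mathcal F_\mu$. Then $\mathcal K_\mu(\mathcal K_\mu+\epsilon\mathcal I)^{-1}$ is trace class; let $s_{\mu,\epsilon}=\operatorname{tr}\big(\mathcal K_\mu(\mathcal K_\mu+\epsilon\mathcal I)^{-1}\big)$ be its trace. For some integer $0\le s\le\lceil 36\,s_{\mu,\epsilon}\rceil$ there exist distinct frequencies $\xi_1,\dots,\xi_s\in\mathbb{C}$, all of them real, such that the following holds. Let $\mathbf C_s:L_2(T)\to\mathbb C^s$ be given by $[\mathbf C_s g](j)=\frac1T\int_0^T g(t)e^{-2\pi i\xi_j t}\,dt$. Then $\mathbf C_s\mathbf C_s^*$ is invertible, and with $\mathbf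 Z=(\mathbf C_s\mathbf C_s^*)^{-1}\mathbf C_s\mathcal F_\mu^*:L_2(\mu)\to\mathbb C^s$, with $\varphi_t\in L_2(\mu)$, $\varphi_t(\xi)=e^{-2\pi i t\xi}$, and with $\boldsymbol\phi_t\in\mathbb C^s$, $\boldsymbol\phi_t(j)=e^{-2\pi i t\xi_j}$, the operator $\mathcal K_\mu-\mathbf C_s^*\mathbf Z\mathbf Z^*\mathbf C_s$ is trace class, the function $t\mapsto\|\varphi_t-\mathbf Z^*\boldsymbol\phi_t\|_\mu^2$ is integrable on $[0,T]$, and $$\operatorname{tr}\big(\mathcal K_\mu-\mathbf C_s^*\mathbf Z\mathbf Z^*\mathbf C_s\big)=\frac1T\int_0^T\|\varphi_t-\mathbf Z^*\boldsymbol\phi_t\|_\mu^2\,dt\ \le\ 4\,\epsilon\, s_{\mu,\epsilon}.$$ -/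

import Mathlib

open MeasureTheory ProbabilityTheory
open scoped ENNReal InnerProductSpace

universe u

noncomputable section

namespace FourierSubset

/-- The uniform probability measure on `[0, T]`. -/
def timeMeasure (T : ℝ) : Measure ℝ := volume[|Set.Icc 0 T]

instance (T : ℝ) : IsZeroOrProbabilityMeasure (timeMeasure T) := by
  unfold timeMeasure; infer_instance

theorem isProbabilityMeasure_timeMeasure {T : ℝ} (hT : 0 < T) :
    IsProbabilityMeasure (timeMeasure T) :=
  cond_isProbabilityMeasure_of_finite (by simp [hT]) (by simp)

/-- Integration against the uniform measure is `(1/T) ∫_0^T`. -/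
theorem integral_timeMeasure {T : ℝ} (hT : 0 < T) (f : ℝ → ℂ) :
    ∫ t, f t ∂(timeMeasure T) = (1 / T : ℂ) * ∫ t in (0 : ℝ)..T, f t := by
  rw [timeMeasure, ProbabilityTheory.cond, integral_smul_measure,
    intervalIntegral.integral_of_le hT.le, integral_Icc_eq_integral_Ioc]
  simp [hT.le]

/-- `L_2(T)`: complex square integrable functions for the uniform probability measure on `[0, T]`,
so that `⟪a, b⟫ = (1/T) ∫_0^T conj (a t) * b t dt`. -/
abbrev L2T (T : ℝ) : Type := Lp ℂ 2 (timeMeasure T)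

/-- The exponential `e^{-2 π i ξ t}`, for a possibly complex frequency `ξ`. -/
def wave (ξ : ℂ) (t : ℝ) : ℂ := Complex.exp (-2 * Real.pi * Complex.I * ξ * t)

theorem continuous_wave (ξ : ℂ) : Continuous (wave ξ) := by
  unfold wave; fun_prop

theorem norm_wave_real (ξ t : ℝ) : ‖wave ξ t‖ = 1 := by
  rw [wave, show (-2 * Real.pi * Complex.I * ξ * t : ℂ)
    = ((-2 * Real.pi * ξ * t : ℝ) : ℂ) * Complex.I by push_cast; ring,
    Complex.norm_exp_ofReal_mul_I]

theorem memLp_conj_wave (T : ℝ) (ξ : ℂ) :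
    MemLp (fun t => starRingEnd ℂ (wave ξ t)) 2 (timeMeasure T) := by
  have hc : Continuous fun t => starRingEnd ℂ (wave ξ t) :=
    Complex.continuous_conj.comp (continuous_wave ξ)
  obtain ⟨C, hC⟩ := (isCompact_Icc (a := (0 : ℝ)) (b := T)).exists_bound_of_continuousOn
    hc.continuousOn
  refine MemLp.of_bound hc.aestronglyMeasurable C ?_
  filter_upwards [ae_cond_mem (μ := volume) (measurableSet_Icc (a := (0 : ℝ)) (b := T))] with t ht
  exact hC t ht

theorem integral_mul_wave_eq_inner (T : ℝ) (ξ : ℂ) (f : L2T T) :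
    ∫ t, f t * wave ξ t ∂(timeMeasure T) = ⟪(memLp_conj_wave T ξ).toLp, f⟫_ℂ := by
  rw [L2.inner_def]
  refine integral_congr_ae ?_
  filter_upwards [(memLp_conj_wave T ξ).coeFn_toLp] with t ht
  rw [ht]
  simp [RCLike.inner_apply]

/-- The functional `f ↦ (1/T) ∫_0^T f(t) e^{-2 π i ξ t} dt` on `L_2(T)`. -/
def freqFunctional (T : ℝ) (ξ : ℂ) : L2T T →L[ℂ] ℂ :=
  LinearMap.mkContinuous
    { toFun := fun f => ∫ t, f t * wave ξ t ∂(timeMeasure T)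
      map_add' := fun f g => by simp only [integral_mul_wave_eq_inner, inner_add_right]
      map_smul' := fun c f => by
        simp only [integral_mul_wave_eq_inner, inner_smul_right, RingHom.id_apply, smul_eq_mul] }
    ‖(memLp_conj_wave T ξ).toLp‖
    (fun f => by
      simp only [LinearMap.coe_mk, AddHom.coe_mk, integral_mul_wave_eq_inner]
      exact norm_inner_le_norm _ _)

theorem freqFunctional_apply {T : ℝ} (hT : 0 < T) (ξ : ℂ) (f : L2T T) :
    freqFunctional T ξ f
      = (1 / T : ℂ) * ∫ t in (0 : ℝ)..T, f t * Complex.exp (-2 * Real.pi * Complex.I * ξ * t) :=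
  integral_timeMeasure hT _

theorem norm_freqFunctional_real_le (T ξ : ℝ) (f : L2T T) : ‖freqFunctional T ξ f‖ ≤ ‖f‖ := by
  have h : ‖((memLp_conj_wave T ξ).toLp : L2T T)‖ ≤ 1 := by
    refine (Lp.norm_le_of_ae_bound (C := 1) zero_le_one ?_).trans ?_
    · filter_upwards [(memLp_conj_wave T ξ).coeFn_toLp] with t ht
      rw [ht, RCLike.norm_conj, norm_wave_real]
    · rw [mul_one]
      refine Real.rpow_le_one (by positivity) ?_ (by norm_num)
      exact ENNReal.toReal_le_of_le_ofReal zero_le_one (by simpa using prob_le_one)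
  refine le_trans (le_of_eq (congrArg norm (integral_mul_wave_eq_inner T ξ f))) ?_
  exact (norm_inner_le_norm _ _).trans (mul_le_of_le_one_left (norm_nonneg f) h)

theorem continuous_freqFunctional_real (T : ℝ) (f : L2T T) :
    Continuous fun ξ : ℝ => freqFunctional T ξ f := by
  have hf : Integrable f (timeMeasure T) := (Lp.memLp f).integrable (by norm_num)
  refine continuous_of_dominated (F := fun (ξ : ℝ) t => f t * wave ξ t) (bound := fun t => ‖f t‖)
    (fun ξ => hf.1.mul (continuous_wave _).aestronglyMeasurable) (fun ξ => ?_) hf.norm ?_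
  · filter_upwards with t
    rw [norm_mul, norm_wave_real, mul_one]
  · filter_upwards with t
    unfold wave
    fun_prop

variable (μ : Measure ℝ) [IsProbabilityMeasure μ]

theorem memLp_freqFunctional (T : ℝ) (f : L2T T) :
    MemLp (fun ξ : ℝ => freqFunctional T ξ f) 2 μ :=
  MemLp.of_bound (continuous_freqFunctional_real T f).aestronglyMeasurable ‖f‖
    (Filter.Eventually.of_forall fun ξ => norm_freqFunctional_real_le T ξ f)

/-- The Fourier transform operator `F_μ : L_2(T) → L_2(μ)`,
`[F_μ f](ξ) = (1/T) ∫_0^T f(t) e^{-2 π i t ξ} dt`. -/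
def fourierOp (T : ℝ) : L2T T →L[ℂ] Lp ℂ 2 μ :=
  LinearMap.mkContinuous
    { toFun := fun f => (memLp_freqFunctional μ T f).toLp
      map_add' := fun f g => by
        rw [← MemLp.toLp_add]
        exact MemLp.toLp_congr _ _ (Filter.Eventually.of_forall fun ξ => by simp)
      map_smul' := fun c f => by
        rw [RingHom.id_apply, ← MemLp.toLp_const_smul]
        exact MemLp.toLp_congr _ _ (Filter.Eventually.of_forall fun ξ => by simp) }
    1
    (fun f => by
      refine (Lp.norm_le_of_ae_bound (C := ‖f‖) (norm_nonneg f) ?_).trans ?_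
      · filter_upwards [(memLp_freqFunctional μ T f).coeFn_toLp] with ξ hξ
        simp only [LinearMap.coe_mk, AddHom.coe_mk]
        rw [hξ]
        exact norm_freqFunctional_real_le T ξ f
      · simp [measureUnivNNReal])

/-- The kernel operator `K_μ = F_μ^* F_μ` on `L_2(T)`. -/
def kernelOp (T : ℝ) : L2T T →L[ℂ] L2T T :=
  (ContinuousLinearMap.adjoint (fourierOp μ T)).comp (fourierOp μ T)

/-- `[F_μ^* g](t) = ∫ g(ξ) e^{2 π i ξ t} dμ(ξ)` for almost every `t`. -/
theorem adjoint_fourierOp_ae (T : ℝ) (g : Lp ℂ 2 μ) :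
    ContinuousLinearMap.adjoint (fourierOp μ T) g
      =ᵐ[timeMeasure T] fun t => ∫ ξ : ℝ, starRingEnd ℂ (wave ξ t) * g ξ ∂μ := by
  have hg : Integrable g μ := (Lp.memLp g).integrable (by norm_num)
  have hb : MemLp (fun t => ∫ ξ : ℝ, starRingEnd ℂ (wave ξ t) * g ξ ∂μ) 2 (timeMeasure T) := by
    refine MemLp.of_bound (C := ∫ ξ, ‖g ξ‖ ∂μ) (Continuous.aestronglyMeasurable ?_)
      (Filter.Eventually.of_forall fun t => ?_)
    · refine continuous_of_dominated (bound := fun ξ => ‖g ξ‖) (fun t => ?_) (fun t => ?_)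
        hg.norm ?_
      · refine Continuous.aestronglyMeasurable ?_ |>.mul hg.1
        unfold wave
        fun_prop
      · filter_upwards with ξ
        rw [norm_mul, RCLike.norm_conj, norm_wave_real, one_mul]
      · filter_upwards with ξ
        unfold wave
        fun_prop
    · refine (norm_integral_le_integral_norm _).trans (le_of_eq ?_)
      refine integral_congr_ae (Filter.Eventually.of_forall fun ξ => ?_)
      simp only [norm_mul, RCLike.norm_conj, norm_wave_real, one_mul]
  suffices h : ContinuousLinearMap.adjoint (fourierOp μ T) g = hb.toLp by
    rw [h]; exact hb.coeFn_toLp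
  refine ext_inner_left ℂ fun f => ?_
  have hf : Integrable f (timeMeasure T) := (Lp.memLp f).integrable (by norm_num)
  rw [ContinuousLinearMap.adjoint_inner_right, L2.inner_def, L2.inner_def]
  have e1 : ∫ ξ, ⟪(fourierOp μ T f) ξ, g ξ⟫_ℂ ∂μ
      = ∫ ξ : ℝ, ∫ t, starRingEnd ℂ (f t) * g ξ * starRingEnd ℂ (wave ξ t)
          ∂(timeMeasure T) ∂μ := by
    refine integral_congr_ae ?_
    filter_upwards [(memLp_freqFunctional μ T f).coeFn_toLp] with ξ hξ
    have : (fourierOp μ T f) ξ = ∫ t, f t * wave ξ t ∂(timeMeasure T) := hξ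
    rw [this, RCLike.inner_apply, ← integral_conj, ← integral_const_mul]
    refine integral_congr_ae (Filter.Eventually.of_forall fun t => ?_)
    simp only [map_mul]
    ring
  have e2 : ∫ t, ⟪f t, (hb.toLp : L2T T) t⟫_ℂ ∂(timeMeasure T)
      = ∫ t, ∫ ξ : ℝ, starRingEnd ℂ (f t) * g ξ * starRingEnd ℂ (wave ξ t)
          ∂μ ∂(timeMeasure T) := by
    refine integral_congr_ae ?_
    filter_upwards [hb.coeFn_toLp] with t ht
    rw [ht, RCLike.inner_apply, mul_comm, ← integral_const_mul]
    refine integral_congr_ae (Filter.Eventually.of_forall fun ξ => ?_)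
    ring
  rw [e1, e2]
  refine integral_integral_swap ?_
  have hcf : Integrable (fun t => starRingEnd ℂ (f t)) (timeMeasure T) :=
    (integrable_norm_iff
      (Complex.continuous_conj.comp_aestronglyMeasurable hf.1)).1 (by simpa using hf.norm)
  have hp : Integrable (fun p : ℝ × ℝ => starRingEnd ℂ (f p.2) * g p.1)
      (μ.prod (timeMeasure T)) := by
    simpa only [mul_comm] using hg.mul_prod hcf
  refine hp.mul_bdd (c := 1) (Continuous.aestronglyMeasurable ?_)
    (Filter.Eventually.of_forall fun p => ?_)
  · unfold wave
    fun_prop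
  · rw [RCLike.norm_conj, norm_wave_real]

/-- `[K_μ z](t) = ∫ e^{2 π i ξ t} ((1/T) ∫_0^T z(r) e^{-2 π i ξ r} dr) dμ(ξ)` for a.e. `t`. -/
theorem kernelOp_ae {T : ℝ} (hT : 0 < T) (z : L2T T) :
    kernelOp μ T z =ᵐ[timeMeasure T] fun t =>
      ∫ ξ : ℝ, Complex.exp (2 * Real.pi * Complex.I * ξ * t) *
        ((1 / T : ℂ) * ∫ r in (0 : ℝ)..T, z r * Complex.exp (-2 * Real.pi * Complex.I * ξ * r))
        ∂μ := by
  refine (adjoint_fourierOp_ae μ T (fourierOp μ T z)).trans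
    (Filter.Eventually.of_forall fun t => ?_)
  refine integral_congr_ae ?_
  filter_upwards [(memLp_freqFunctional μ T z).coeFn_toLp] with ξ hξ
  have h1 : (fourierOp μ T z) ξ = freqFunctional T ξ z := hξ
  have h2 : starRingEnd ℂ (wave ξ t) = Complex.exp (2 * Real.pi * Complex.I * ξ * t) := by
    rw [wave, ← Complex.exp_conj]
    simp [map_ofNat]
  rw [h1, h2, freqFunctional_apply hT]

/-- `A` is trace class with trace `τ`: in every orthonormal (Hilbert) basis the series
`∑ ⟪b i, A (b i)⟫` converges (unconditionally) to `τ`. -/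
def HasTrace {H : Type u} [NormedAddCommGroup H] [InnerProductSpace ℂ H]
    (A : H →L[ℂ] H) (τ : ℂ) : Prop :=
  ∀ (ι : Type u) (b : HilbertBasis ι ℂ H), HasSum (fun i => ⟪b i, A (b i)⟫_ℂ) τ

/-- The trace of a trace class operator (and `0` if `A` is not trace class). -/
def opTrace {H : Type*} [NormedAddCommGroup H] [InnerProductSpace ℂ H]
    (A : H →L[ℂ] H) : ℂ :=
  open Classical in if h : ∃ τ, HasTrace A τ then h.choose else 0

/-- The operator `K_μ (K_μ + ε I)⁻¹`, for `ε > 0`. -/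
def ridgeOp (T ε : ℝ) : L2T T →L[ℂ] L2T T :=
  kernelOp μ T * Ring.inverse (kernelOp μ T + (ε : ℂ) • 1)

theorem isUnit_kernelOp_add (T : ℝ) {ε : ℝ} (hε : 0 < ε) :
    IsUnit (kernelOp μ T + (ε : ℂ) • 1) := by
  refine ContinuousLinearMap.isUnit_of_forall_le_norm_inner_map _ (c := ε.toNNReal)
    (Real.toNNReal_pos.2 hε) fun x => ?_
  refine le_trans ?_ (Complex.re_le_norm _)
  have h1 : ⟪kernelOp μ T x, x⟫_ℂ = (‖fourierOp μ T x‖ ^ 2 : ℝ) := by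
    rw [kernelOp, ContinuousLinearMap.comp_apply, ContinuousLinearMap.adjoint_inner_left,
      inner_self_eq_norm_sq_to_K]
    simp
  have h2 : ⟪(ε : ℂ) • x, x⟫_ℂ = (ε * ‖x‖ ^ 2 : ℝ) := by
    rw [inner_smul_left, inner_self_eq_norm_sq_to_K]
    simp
  have h3 : (kernelOp μ T + (ε : ℂ) • 1) x = kernelOp μ T x + (ε : ℂ) • x := rfl
  rw [h3, inner_add_left, h1, h2, Complex.add_re, Complex.ofReal_re, Complex.ofReal_re,
    Real.coe_toNNReal _ hε.le]
  have := sq_nonneg ‖fourierOp μ T x‖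
  nlinarith

/-- The Fourier statistical dimension `s_{μ,ε} = tr (K_μ (K_μ + ε I)⁻¹)`. -/
def statDim (T ε : ℝ) : ℝ := (opTrace (ridgeOp μ T ε)).re

/-- The operator `C_s : L_2(T) → ℂ^s`, `[C_s g](j) = (1/T) ∫_0^T g(t) e^{-2 π i ξ_j t} dt`. -/
def subsetOp (T : ℝ) {s : ℕ} (ξ : Fin s → ℂ) : L2T T →L[ℂ] EuclideanSpace ℂ (Fin s) :=
  ((EuclideanSpace.equiv (Fin s) ℂ).symm : (Fin s → ℂ) →L[ℂ] EuclideanSpace ℂ (Fin s)).comp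
    (ContinuousLinearMap.pi fun j => freqFunctional T (ξ j))

theorem subsetOp_apply {T : ℝ} (hT : 0 < T) {s : ℕ} (ξ : Fin s → ℂ) (g : L2T T) (j : Fin s) :
    subsetOp T ξ g j
      = (1 / T : ℂ) *
        ∫ t in (0 : ℝ)..T, g t * Complex.exp (-2 * Real.pi * Complex.I * ξ j * t) :=
  freqFunctional_apply hT (ξ j) g

/-- The operator `C_s C_s^*` on `ℂ^s`. -/
def subsetGram (T : ℝ) {s : ℕ} (ξ : Fin s → ℂ) :
    EuclideanSpace ℂ (Fin s) →L[ℂ] EuclideanSpace ℂ (Fin s) :=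
  (subsetOp T ξ).comp (ContinuousLinearMap.adjoint (subsetOp T ξ))

/-- The operator `Z = (C_s C_s^*)⁻¹ C_s F_μ^* : L_2(μ) → ℂ^s`. -/
def projOp (T : ℝ) {s : ℕ} (ξ : Fin s → ℂ) : Lp ℂ 2 μ →L[ℂ] EuclideanSpace ℂ (Fin s) :=
  (Ring.inverse (subsetGram T ξ)).comp
    ((subsetOp T ξ).comp (ContinuousLinearMap.adjoint (fourierOp μ T)))

/-- The operator `K_μ - C_s^* Z Z^* C_s` on `L_2(T)`. -/
def residualOp (T : ℝ) {s : ℕ} (ξ : Fin s → ℂ) : L2T T →L[ℂ] L2T T :=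
  kernelOp μ T -
    (ContinuousLinearMap.adjoint (subsetOp T ξ)).comp
      ((projOp μ T ξ).comp
        ((ContinuousLinearMap.adjoint (projOp μ T ξ)).comp (subsetOp T ξ)))

theorem memLp_wave (t : ℝ) : MemLp (fun ξ : ℝ => wave ξ t) 2 μ :=
  MemLp.of_bound (by unfold wave; fun_prop) 1
    (Filter.Eventually.of_forall fun ξ => (norm_wave_real ξ t).le)

/-- `φ_t ∈ L_2(μ)`, `φ_t(ξ) = e^{-2 π i t ξ}`. -/
def phi (t : ℝ) : Lp ℂ 2 μ := (memLp_wave μ t).toLp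

/-- The vector `φ_t ∈ ℂ^s` with coordinates `φ_t(j) = e^{-2 π i t ξ_j}`. -/
def phiVec {s : ℕ} (ξ : Fin s → ℂ) (t : ℝ) : EuclideanSpace ℂ (Fin s) :=
  WithLp.toLp 2 fun j => wave (ξ j) t

/-- `‖φ_t - Z^* φ_t‖_μ^2`, with `φ_t ∈ L_2(μ)` on the left and `φ_t ∈ ℂ^s` on the right. -/
def residualSq (T : ℝ) {s : ℕ} (ξ : Fin s → ℂ) (t : ℝ) : ℝ :=
  ‖phi μ t - ContinuousLinearMap.adjoint (projOp μ T ξ) (phiVec ξ t)‖ ^ 2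

end FourierSubset

end

/-! Write `e ξ` for `atom T ξ`, the unit vector of L²(T) representing evaluation of the transform at
`ξ`; then K = ∫ e e* dμ weakly. If P is the orthogonal projection onto the span of the chosen atoms,
then C*ZZ*C = PKP*, and both the trace and the time average equal ∫ ‖e ξ - P (e ξ)‖² dμ
(`hasTrace_residualOp`, `integral_residualSq`). It remains to find few atoms whose span makes this
integral small.

The choice is by volume sampling. Let G_k be the mean Gram determinant of k independent atoms. Base
times squared height gives G_{k+1} as the mean of the Gram determinant times the residual integral
(`gramMean_succ`), so under the Gram weight the mean residual is G_{k+1} / G_k. With p_k = ε⁻ᵏ G_k /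
k! this ratio is ε (k+1) p_{k+1} / p_k.

The sum of the p_k is the Fredholm determinant D of K/ε. Fredholm's first minor, a series of
bordered Gram determinants, represents the resolvent: it equals ε D ⟪(K+ε)⁻¹u, w⟫
(`fredholmMinor_eq_mul_inner`). Put u = w = e ξ and integrate: ∑ (k+1) p_{k+1} = s D with s the
statistical dimension (`hasSum_gramMean_succ`). So p / D has mean s, and Markov's inequality yields
k < ⌈36 s⌉ with (k+1) p_{k+1} ≤ 4 s p_k (`exists_lt_succ_mul_le`). Some k-tuple of positive Gram
determinant does at least as well as the mean. -/

noncomputable section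

namespace FourierSubset

/-! ### Gram determinants, bordered Gram determinants and orthogonal residuals. -/

section Bordered

variable {H : Type*} [NormedAddCommGroup H] [InnerProductSpace ℂ H]

instance {k : ℕ} (v : Fin k → H) : FiniteDimensional ℂ (Submodule.span ℂ (Set.range v)) :=
  FiniteDimensional.span_of_finite ℂ (Set.finite_range v)

/-- The residual `w ↦ w - P w` of the orthogonal projection `P` onto the span of `v`. -/
def perpProj {k : ℕ} (v : Fin k → H) : H →L[ℂ] H :=
  1 - (Submodule.span ℂ (Set.range v)).starProjection

theorem perpProj_apply {k : ℕ} (v : Fin k → H) (w : H) :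
    perpProj v w = w - (Submodule.span ℂ (Set.range v)).starProjection w := rfl

theorem perpProj_mem {k : ℕ} (v : Fin k → H) (w : H) :
    perpProj v w ∈ (Submodule.span ℂ (Set.range v)).orthogonal :=
  Submodule.sub_starProjection_mem_orthogonal w

theorem sub_perpProj_mem {k : ℕ} (v : Fin k → H) (w : H) :
    w - perpProj v w ∈ Submodule.span ℂ (Set.range v) := by
  rw [perpProj_apply, sub_sub_cancel]
  exact Submodule.starProjection_apply_mem _ w

theorem inner_perpProj_right {k : ℕ} (v : Fin k → H) (i : Fin k) (w : H) :
    ⟪v i, perpProj v w⟫_ℂ = 0 :=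
  Submodule.inner_right_of_mem_orthogonal (Submodule.subset_span (Set.mem_range_self i))
    (perpProj_mem v w)

theorem inner_perpProj_self {k : ℕ} (v : Fin k → H) (w : H) :
    ⟪w, perpProj v w⟫_ℂ = ((‖perpProj v w‖ ^ 2 : ℝ) : ℂ) := by
  conv_lhs => rw [← sub_add_cancel w (perpProj v w)]
  rw [inner_add_left, sub_add_cancel,
    Submodule.inner_right_of_mem_orthogonal (sub_perpProj_mem v w) (perpProj_mem v w),
    inner_self_eq_norm_sq_to_K]
  simp

theorem norm_perpProj_le {k : ℕ} (v : Fin k → H) (w : H) : ‖perpProj v w‖ ≤ ‖w‖ := by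
  have h : ‖perpProj v w‖ ^ 2 ≤ ‖w‖ * ‖perpProj v w‖ := by
    rw [← Complex.norm_of_nonneg (sq_nonneg ‖perpProj v w‖), ← inner_perpProj_self]
    exact norm_inner_le_norm _ _
  by_contra! hlt
  nlinarith [norm_nonneg w]

theorem perpProj_zero (v : Fin 0 → H) (w : H) : perpProj v w = w := by
  have h := sub_perpProj_mem v w
  rw [Set.range_eq_empty, Submodule.span_empty, Submodule.mem_bot, sub_eq_zero] at h
  exact h.symm

/-- The determinant of the Gram matrix of `v`, bordered by the row `⟪u, ·⟫` and the
column `⟪·, w⟫`. -/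
def borderedDet {k : ℕ} (u w : H) (v : Fin k → H) : ℂ :=
  (Matrix.of fun i j : Fin (k + 1) =>
    ⟪(Fin.cons u v : Fin (k + 1) → H) i, (Fin.cons w v : Fin (k + 1) → H) j⟫_ℂ).det

/-- The cofactors of the first column do not involve `w`, so linearity in `w` can be read off. -/
theorem borderedDet_eq_column_expansion {k : ℕ} (u w : H) (v : Fin k → H) :
    borderedDet u w v = ∑ i : Fin (k + 1), (-1) ^ (i : ℕ) *
      ⟪(Fin.cons u v : Fin (k + 1) → H) i, w⟫_ℂ * (Matrix.of fun a b : Fin k =>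
        ⟪(Fin.cons u v : Fin (k + 1) → H) (i.succAbove a), v b⟫_ℂ).det := by
  rw [borderedDet, Matrix.det_succ_column_zero]
  rfl

theorem borderedDet_add_right {k : ℕ} (u w w' : H) (v : Fin k → H) :
    borderedDet u (w + w') v = borderedDet u w v + borderedDet u w' v := by
  simp only [borderedDet_eq_column_expansion, inner_add_right, mul_add, add_mul,
    Finset.sum_add_distrib]

theorem borderedDet_smul_right {k : ℕ} (u w : H) (c : ℂ) (v : Fin k → H) :
    borderedDet u (c • w) v = c * borderedDet u w v := by
  simp only [borderedDet_eq_column_expansion, inner_smul_right, Finset.mul_sum]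
  exact Finset.sum_congr rfl fun i _ => by ring

theorem borderedDet_eq_zero_of_mem_span {k : ℕ} (u w : H) (v : Fin k → H)
    (hw : w ∈ Submodule.span ℂ (Set.range v)) : borderedDet u w v = 0 := by
  induction hw using Submodule.span_induction with
  | mem x hx =>
    obtain ⟨i, rfl⟩ := hx
    exact Matrix.det_zero_of_column_eq (Fin.succ_ne_zero i).symm fun j => by simp
  | zero => simpa using borderedDet_smul_right u 0 0 v
  | add x y _ _ hx hy => rw [borderedDet_add_right, hx, hy, add_zero]
  | smul c x _ hx => rw [borderedDet_smul_right, hx, mul_zero]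

/-- The part of `w` in the span of `v` contributes nothing, so `w` may be replaced by its residual;
this is orthogonal to every `v i`, and only the top entry of the first column survives. -/
theorem borderedDet_eq_mul_inner {k : ℕ} (u w : H) (v : Fin k → H) :
    borderedDet u w v = (Matrix.gram ℂ v).det * ⟪u, perpProj v w⟫_ℂ := by
  rw [← sub_add_cancel w (perpProj v w), borderedDet_add_right,
    borderedDet_eq_zero_of_mem_span _ _ _ (sub_perpProj_mem v w), zero_add,
    sub_add_cancel, borderedDet_eq_column_expansion, Fin.sum_univ_succ]
  simp only [Fin.val_zero, pow_zero, one_mul, Fin.cons_zero, Fin.zero_succAbove, Fin.cons_succ,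
    inner_perpProj_right, mul_zero, zero_mul, Finset.sum_const_zero, add_zero]
  exact mul_comm _ _

theorem det_gram_cons {k : ℕ} (u : H) (v : Fin k → H) :
    (Matrix.gram ℂ (Fin.cons u v : Fin (k + 1) → H)).det
      = (Matrix.gram ℂ v).det * ((‖perpProj v u‖ ^ 2 : ℝ) : ℂ) := by
  rw [← inner_perpProj_self, ← borderedDet_eq_mul_inner]
  rfl

/-- The Gram determinant of `v`, as a real number. -/
def gramDet {k : ℕ} (v : Fin k → H) : ℝ := (Matrix.gram ℂ v).det.re

theorem det_gram_eq_gramDet {k : ℕ} (v : Fin k → H) : (Matrix.gram ℂ v).det = (gramDet v : ℂ) := by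
  have h := (Matrix.posSemidef_gram ℂ v).det_nonneg
  exact Complex.ext rfl (Complex.nonneg_iff.1 h).2.symm

theorem gramDet_nonneg {k : ℕ} (v : Fin k → H) : 0 ≤ gramDet v :=
  (Complex.nonneg_iff.1 (Matrix.posSemidef_gram ℂ v).det_nonneg).1

theorem gramDet_cons {k : ℕ} (u : H) (v : Fin k → H) :
    gramDet (Fin.cons u v : Fin (k + 1) → H) = gramDet v * ‖perpProj v u‖ ^ 2 := by
  have h := det_gram_cons u v
  rw [det_gram_eq_gramDet, det_gram_eq_gramDet] at h
  exact_mod_cast h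

theorem gramDet_zero (v : Fin 0 → H) : gramDet v = 1 := by simp [gramDet]

/-- Hadamard's inequality: the determinant is a product of squared heights, each at most 1. -/
theorem gramDet_le_one {k : ℕ} (v : Fin k → H) (hv : ∀ i, ‖v i‖ ≤ 1) : gramDet v ≤ 1 := by
  induction k with
  | zero => exact (gramDet_zero v).le
  | succ k ih =>
    rw [← Fin.cons_self_tail v, gramDet_cons]
    refine mul_le_one₀ (ih _ fun i => hv i.succ) (by positivity) ?_
    exact pow_le_one₀ (norm_nonneg _) ((norm_perpProj_le _ _).trans (hv 0))

theorem linearIndependent_of_gramDet_pos {k : ℕ} {v : Fin k → H} (h : 0 < gramDet v) :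
    LinearIndependent ℂ v :=
  Matrix.linearIndependent_of_det_gram_ne_zero (by
    rw [det_gram_eq_gramDet]; exact_mod_cast h.ne')

/-- Expansion along the first row, the source of Fredholm's recursion. Each remaining minor is again
a bordered determinant, with `v i` in the role of `u`. -/
theorem borderedDet_succ {k : ℕ} (u w : H) (v : Fin (k + 1) → H) :
    borderedDet u w v = ⟪u, w⟫_ℂ * gramDet v
      - ∑ i, ⟪u, v i⟫_ℂ * borderedDet (v i) w (fun a => v (i.succAbove a)) := by
  rw [borderedDet, Matrix.det_succ_row_zero, Fin.sum_univ_succ, sub_eq_add_neg,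
    ← Finset.sum_neg_distrib]
  congr 1
  · rw [← det_gram_eq_gramDet, Fin.val_zero, pow_zero, one_mul]
    rfl
  · refine Finset.sum_congr rfl fun i _ => ?_
    -- Moving row `i` to the top costs (-1)^i; with the cofactor sign (-1)^(i+1) this leaves the
    -- uniform minus sign.
    have h := Matrix.det_permute (i.cycleRange.symm) (Matrix.of fun a b : Fin (k + 1) =>
      ⟪v a, (Fin.cons w fun c => v (i.succAbove c) : Fin (k + 1) → H) b⟫_ℂ)
    rw [Equiv.Perm.sign_symm, Fin.sign_cycleRange] at h
    have h1 : (Matrix.of fun a b : Fin (k + 1) =>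
        ⟪v a, (Fin.cons w fun c => v (i.succAbove c) : Fin (k + 1) → H) b⟫_ℂ).submatrix
          i.cycleRange.symm id = Matrix.of fun a b : Fin (k + 1) =>
        ⟪(Fin.cons (v i) fun c => v (i.succAbove c) : Fin (k + 1) → H) a,
          (Fin.cons w fun c => v (i.succAbove c) : Fin (k + 1) → H) b⟫_ℂ := by
      ext a b
      refine Fin.cases ?_ (fun a => ?_) a <;> simp
    rw [h1] at h
    rw [borderedDet, h]
    have h2 : ((Matrix.of fun a b : Fin (k + 1 + 1) => ⟪(Fin.cons u v : Fin (k + 1 + 1) → H) a,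
        (Fin.cons w v : Fin (k + 1 + 1) → H) b⟫_ℂ).submatrix Fin.succ i.succ.succAbove)
        = Matrix.of fun a b : Fin (k + 1) =>
      ⟪v a, (Fin.cons w fun c => v (i.succAbove c) : Fin (k + 1) → H) b⟫_ℂ := by
      ext a b
      refine Fin.cases ?_ (fun b => ?_) b <;> simp
    rw [h2]
    simp [pow_succ]
    ring

end Bordered

/-! ### Means of these determinants over independent samples. -/

section DeterminantalMeans

variable {H : Type*} [NormedAddCommGroup H] [InnerProductSpace ℂ H]

theorem measurable_det_inner {Y : Type*} [MeasurableSpace Y] {n : ℕ} {f g : Y → Fin n → H}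
    (hf : ∀ i, StronglyMeasurable fun y => f y i) (hg : ∀ i, StronglyMeasurable fun y => g y i) :
    Measurable fun y => (Matrix.of fun i j => ⟪f y i, g y j⟫_ℂ).det := by
  simp only [Matrix.det_apply, Matrix.of_apply]
  refine Finset.measurable_fun_sum _ fun σ _ => Measurable.const_smul ?_ _
  exact Finset.measurable_fun_prod _ fun i _ => ((hf _).inner (hg _)).measurable

theorem measurable_gramDet {Y : Type*} [MeasurableSpace Y] {n : ℕ} {f : Y → Fin n → H}
    (hf : ∀ i, StronglyMeasurable fun y => f y i) : Measurable fun y => gramDet (f y) :=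
  Complex.measurable_re.comp (measurable_det_inner hf hf)

theorem measurable_borderedDet {Y : Type*} [MeasurableSpace Y] {n : ℕ} {f g : Y → H}
    {h : Y → Fin n → H} (hf : StronglyMeasurable f) (hg : StronglyMeasurable g)
    (hh : ∀ i, StronglyMeasurable fun y => h y i) :
    Measurable fun y => borderedDet (f y) (g y) (h y) := by
  refine measurable_det_inner (fun i => ?_) (fun i => ?_)
  · refine Fin.cases ?_ (fun i => ?_) i
    · simpa using hf
    · simpa using hh i
  · refine Fin.cases ?_ (fun i => ?_) i
    · simpa using hg
    · simpa using hh i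

/-- The bound does not grow with `k`, so 1/k! alone makes the Fredholm series converge. -/
theorem norm_borderedDet_le {k : ℕ} (u w : H) {v : Fin k → H} (hv : ∀ i, ‖v i‖ ≤ 1) :
    ‖borderedDet u w v‖ ≤ ‖u‖ * ‖w‖ := by
  rw [borderedDet_eq_mul_inner, det_gram_eq_gramDet, norm_mul,
    Complex.norm_of_nonneg (gramDet_nonneg v)]
  calc gramDet v * ‖⟪u, perpProj v w⟫_ℂ‖ ≤ 1 * (‖u‖ * ‖w‖) := by
        refine mul_le_mul (gramDet_le_one v hv) ?_ (norm_nonneg _) zero_le_one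
        exact (norm_inner_le_norm _ _).trans
          (mul_le_mul_of_nonneg_left (norm_perpProj_le v w) (norm_nonneg u))
    _ = ‖u‖ * ‖w‖ := one_mul _

variable {X : Type*} [MeasurableSpace X] (μ : Measure X) (e : X → H)

/-- The mean Gram determinant of `k` independent samples from the family `e`. -/
def gramMean (k : ℕ) : ℝ :=
  ∫ z : Fin k → X, gramDet (fun i => e (z i)) ∂(Measure.pi fun _ => μ)

/-- The mean bordered Gram determinant of `k` independent samples from the family `e`. -/
def minorMean (k : ℕ) (u w : H) : ℂ :=
  ∫ z : Fin k → X, borderedDet u w (fun i => e (z i)) ∂(Measure.pi fun _ => μ)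

variable {μ e}

theorem gramMean_nonneg (k : ℕ) : 0 ≤ gramMean μ e k :=
  integral_nonneg fun _ => gramDet_nonneg _

theorem minorMean_smul_left (k : ℕ) (c : ℂ) (u w : H) :
    minorMean μ e k (c • u) w = starRingEnd ℂ c * minorMean μ e k u w := by
  rw [minorMean, minorMean, ← integral_const_mul]
  simp only [borderedDet_eq_mul_inner, inner_smul_left]
  exact integral_congr_ae (Filter.Eventually.of_forall fun z => by ring)

variable [IsProbabilityMeasure μ]

theorem minorMean_zero (u w : H) : minorMean μ e 0 u w = ⟪u, w⟫_ℂ := by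
  simp [minorMean, borderedDet_eq_mul_inner, perpProj_zero]

theorem gramMean_zero : gramMean μ e 0 = 1 := by
  simp [gramMean, gramDet_zero]

theorem gramMean_succ_eq_integral_prod (k : ℕ) :
    gramMean μ e (k + 1) = ∫ p : X × (Fin k → X),
      gramDet (fun i => e (p.2 i)) * ‖perpProj (fun i => e (p.2 i)) (e p.1)‖ ^ 2
      ∂(μ.prod (Measure.pi fun _ => μ)) := by
  have hmp := measurePreserving_piFinSuccAbove (fun _ : Fin (k + 1) => μ) 0
  rw [← hmp.integral_comp', gramMean]
  refine integral_congr_ae (Filter.Eventually.of_forall fun z => ?_)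
  simp only [← gramDet_cons]
  congr 1
  ext i
  refine Fin.cases ?_ (fun i => ?_) i <;> rfl

theorem integrable_gramDet {Y : Type*} [MeasurableSpace Y] {ν : Measure Y} [IsFiniteMeasure ν]
    {k : ℕ} {f : Y → Fin k → H} (hf : ∀ i, StronglyMeasurable fun y => f y i)
    (hn : ∀ y i, ‖f y i‖ ≤ 1) : Integrable (fun y => gramDet (f y)) ν :=
  Integrable.of_bound (measurable_gramDet hf).aestronglyMeasurable 1
    (Filter.Eventually.of_forall fun y => by
      rw [Real.norm_of_nonneg (gramDet_nonneg _)]; exact gramDet_le_one _ (hn y))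

theorem integrable_borderedDet {Y : Type*} [MeasurableSpace Y] {ν : Measure Y} [IsFiniteMeasure ν]
    {k : ℕ} {f : Y → Fin k → H} {g h : Y → H} (hg : StronglyMeasurable g)
    (hh : StronglyMeasurable h) (hf : ∀ i, StronglyMeasurable fun y => f y i)
    (hn : ∀ y i, ‖f y i‖ ≤ 1) {C : ℝ} (hC : ∀ y, ‖g y‖ * ‖h y‖ ≤ C) :
    Integrable (fun y => borderedDet (g y) (h y) (f y)) ν :=
  Integrable.of_bound (measurable_borderedDet hg hh hf).aestronglyMeasurable C
    (Filter.Eventually.of_forall fun y => (norm_borderedDet_le _ _ (hn y)).trans (hC y))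

variable (he : StronglyMeasurable e) (hn : ∀ x, ‖e x‖ = 1)
include hn

theorem norm_minorMean_le (k : ℕ) (u w : H) : ‖minorMean μ e k u w‖ ≤ ‖u‖ * ‖w‖ := by
  refine (norm_integral_le_of_norm_le_const (Filter.Eventually.of_forall fun _ =>
    norm_borderedDet_le u w fun _ => (hn _).le)).trans ?_
  simp

include he

theorem integrable_gramDet_pi (k : ℕ) :
    Integrable (fun z : Fin k → X => gramDet fun i => e (z i)) (Measure.pi fun _ => μ) :=
  integrable_gramDet (fun i => he.comp_measurable (measurable_pi_apply i)) fun _ _ => (hn _).le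

theorem integrable_borderedDet_pi (k : ℕ) (u w : H) :
    Integrable (fun z : Fin k → X => borderedDet u w fun i => e (z i)) (Measure.pi fun _ => μ) :=
  integrable_borderedDet stronglyMeasurable_const stronglyMeasurable_const
    (fun i => he.comp_measurable (measurable_pi_apply i)) (fun _ _ => (hn _).le) fun _ => le_rfl

theorem gramMean_le_one (k : ℕ) : gramMean μ e k ≤ 1 := by
  refine (integral_mono (integrable_gramDet_pi he hn k) (integrable_const 1)
    fun _ => gramDet_le_one _ fun _ => (hn _).le).trans ?_
  simp

theorem minorMean_add_left (k : ℕ) (u u' w : H) :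
    minorMean μ e k (u + u') w = minorMean μ e k u w + minorMean μ e k u' w := by
  rw [minorMean, minorMean, minorMean, ← integral_add (integrable_borderedDet_pi he hn k u w)
    (integrable_borderedDet_pi he hn k u' w)]
  simp only [borderedDet_eq_mul_inner, inner_add_left, mul_add]

/-- The sample `z i` is integrated first: it occurs only as ⟪u, e x⟫⟪e x, ·⟫, which `hK` integrates
to ⟪K u, ·⟫. -/
theorem integral_inner_mul_borderedDet {K : H →L[ℂ] H}
    (hK : ∀ u w, ∫ x, ⟪u, e x⟫_ℂ * ⟪e x, w⟫_ℂ ∂μ = ⟪K u, w⟫_ℂ) (k : ℕ) (i : Fin (k + 1))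
    (u w : H) :
    ∫ z : Fin (k + 1) → X, ⟪u, e (z i)⟫_ℂ * borderedDet (e (z i)) w
        (fun a => e (z (i.succAbove a))) ∂(Measure.pi fun _ => μ) = minorMean μ e k (K u) w := by
  have hmp := measurePreserving_piFinSuccAbove (fun _ : Fin (k + 1) => μ) i
  have h1 := hmp.integral_comp' (g := fun p : X × (Fin k → X) =>
    ⟪u, e p.1⟫_ℂ * borderedDet (e p.1) w (fun a => e (p.2 a)))
  refine Eq.trans ?_ (h1.trans ?_)
  · rfl
  · have h2 : Integrable (fun p : X × (Fin k → X) =>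
        ⟪u, e p.1⟫_ℂ * borderedDet (e p.1) w (fun a => e (p.2 a)))
        (μ.prod (Measure.pi fun _ => μ)) := by
      refine Integrable.bdd_mul (c := ‖u‖) (integrable_borderedDet (C := ‖w‖)
        (he.comp_measurable measurable_fst) stronglyMeasurable_const
        (fun i => he.comp_measurable ((measurable_pi_apply i).comp measurable_snd))
        (fun y i => (hn _).le) fun y => by simp [hn])
        (stronglyMeasurable_const.inner
          (he.comp_measurable measurable_fst)).aestronglyMeasurable
        (Filter.Eventually.of_forall fun p => ?_)
      simpa [hn] using norm_inner_le_norm (𝕜 := ℂ) u (e p.1)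
    refine (integral_prod_symm _ h2).trans (integral_congr_ae (Filter.Eventually.of_forall
      fun z => ?_))
    simp only [borderedDet_eq_mul_inner, ← hK]
    rw [← integral_const_mul]
    exact integral_congr_ae (Filter.Eventually.of_forall fun x => by ring)

/-- The mean of `borderedDet_succ`; the samples are exchangeable, so the `k + 1` terms of the sum
coincide. -/
theorem minorMean_succ {K : H →L[ℂ] H}
    (hK : ∀ u w, ∫ x, ⟪u, e x⟫_ℂ * ⟪e x, w⟫_ℂ ∂μ = ⟪K u, w⟫_ℂ) (k : ℕ) (u w : H) :
    minorMean μ e (k + 1) u w + (k + 1) * minorMean μ e k (K u) w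
      = ⟪u, w⟫_ℂ * gramMean μ e (k + 1) := by
  have hint : ∀ i : Fin (k + 1), Integrable (fun z : Fin (k + 1) → X =>
      ⟪u, e (z i)⟫_ℂ * borderedDet (e (z i)) w (fun a => e (z (i.succAbove a))))
      (Measure.pi fun _ => μ) := fun i => by
    refine Integrable.bdd_mul (c := ‖u‖) (integrable_borderedDet (C := ‖w‖)
      (he.comp_measurable (measurable_pi_apply i)) stronglyMeasurable_const
      (fun j => he.comp_measurable (measurable_pi_apply _))
      (fun y i => (hn _).le) fun y => by simp [hn])
      (stronglyMeasurable_const.inner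
        (he.comp_measurable (measurable_pi_apply i))).aestronglyMeasurable
      (Filter.Eventually.of_forall fun p => ?_)
    simpa [hn] using norm_inner_le_norm (𝕜 := ℂ) u (e (p i))
  have hg : Integrable (fun z : Fin (k + 1) → X => ((gramDet fun i => e (z i) : ℝ) : ℂ))
      (Measure.pi fun _ => μ) := (integrable_gramDet_pi he hn (k + 1)).ofReal
  rw [minorMean]
  simp only [borderedDet_succ]
  rw [integral_sub (hg.const_mul _) (integrable_finsetSum _ fun i _ => hint i),
    integral_finsetSum _ fun i _ => hint i, integral_const_mul]
  simp only [integral_inner_mul_borderedDet he hn hK]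
  rw [integral_complex_ofReal, gramMean]
  simp

theorem integrable_gramDet_mul_norm_sq (k : ℕ) :
    Integrable (fun p : X × (Fin k → X) =>
      gramDet (fun i => e (p.2 i)) * ‖perpProj (fun i => e (p.2 i)) (e p.1)‖ ^ 2)
      (μ.prod (Measure.pi fun _ => μ)) := by
  simp only [← gramDet_cons]
  refine integrable_gramDet (fun i => ?_) fun p i => ?_
  · refine Fin.cases ?_ (fun i => ?_) i
    · exact he.comp_measurable measurable_fst
    · exact he.comp_measurable ((measurable_pi_apply i).comp measurable_snd)
  · refine Fin.cases ?_ (fun i => ?_) i <;> simp [hn]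

/-- Consequently `gramMean (k + 1) / gramMean k` is the mean residual under volume sampling of `k`
atoms. -/
theorem gramMean_succ (k : ℕ) :
    gramMean μ e (k + 1) = ∫ z : Fin k → X, gramDet (fun i => e (z i)) *
      ∫ x, ‖perpProj (fun i => e (z i)) (e x)‖ ^ 2 ∂μ ∂(Measure.pi fun _ => μ) := by
  rw [gramMean_succ_eq_integral_prod,
    integral_prod_symm _ (integrable_gramDet_mul_norm_sq he hn k)]
  simp only [integral_const_mul]

theorem integral_minorMean_self (k : ℕ) :
    ∫ x, minorMean μ e k (e x) (e x) ∂μ = gramMean μ e (k + 1) := by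
  rw [gramMean_succ_eq_integral_prod,
    integral_prod _ (integrable_gramDet_mul_norm_sq he hn k), ← integral_complex_ofReal]
  refine integral_congr_ae (Filter.Eventually.of_forall fun x => ?_)
  simp only [minorMean]
  rw [← integral_complex_ofReal]
  refine integral_congr_ae (Filter.Eventually.of_forall fun z => ?_)
  simp only [borderedDet_eq_mul_inner, det_gram_eq_gramDet, inner_perpProj_self]
  push_cast
  rfl

end DeterminantalMeans

/-- A weight sequence on `ℕ` with mean `s` has, below any `m ≥ 36 s`, an index at which it is
positive and the size-biased ratio `(k + 1) p (k + 1) / p k` is at most `4 s`. -/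
theorem exists_lt_succ_mul_le {p : ℕ → ℝ} {A s : ℝ} {m : ℕ} (hp : ∀ k, 0 ≤ p k) (hp0 : 0 < p 0)
    (hA : HasSum p A) (hs : HasSum (fun k : ℕ => ((k : ℝ) + 1) * p (k + 1)) (s * A))
    (hm : 0 < m) (hms : 36 * s ≤ m) :
    ∃ k < m, 0 < p k ∧ ((k : ℝ) + 1) * p (k + 1) ≤ 4 * s * p k := by
  by_contra! hcon
  have hApos : 0 < A := hp0.trans_le (le_hasSum hA 0 fun k _ => hp k)
  have hs0 : 0 ≤ s := by
    have := hs.nonneg fun k => mul_nonneg (by positivity) (hp (k + 1))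
    exact nonneg_of_mul_nonneg_left this hApos
  -- The negated claim propagates positivity, since its strict inequality makes `p (k + 1)` positive
  -- once `p k` is.
  have hpos : ∀ k ≤ m, 0 < p k := by
    intro k
    induction k with
    | zero => exact fun _ => hp0
    | succ k ih =>
      intro hk
      have h1 := hcon k hk (ih (Nat.le_of_succ_le hk))
      have h2 : 0 < ((k : ℝ) + 1) * p (k + 1) :=
        lt_of_le_of_lt (mul_nonneg (by positivity) (hp k)) h1
      exact pos_of_mul_pos_right h2 (by positivity)
  have hspos : 0 < s := by
    have h1 := le_hasSum hs 0 fun k _ => mul_nonneg (by positivity) (hp (k + 1))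
    have h2 := hpos 1 hm
    refine pos_of_mul_pos_left (lt_of_lt_of_le ?_ h1) hApos.le
    simpa using h2
  set S := ∑ k ∈ Finset.range m, p k
  -- Summing the negated claim over `k < m` against the mean: less than a quarter of the mass lies
  -- below `m`.
  have h1 : 4 * s * S < s * A := by
    refine lt_of_lt_of_le ?_ (sum_le_hasSum (Finset.range m)
      (fun k _ => mul_nonneg (by positivity) (hp (k + 1))) hs)
    rw [Finset.mul_sum]
    refine Finset.sum_lt_sum_of_nonempty (Finset.nonempty_range_iff.2 hm.ne') fun k hk => ?_
    have hk' := Finset.mem_range.1 hk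
    exact hcon k hk' (hpos k hk'.le)
  have hs' : HasSum (fun k : ℕ => (k : ℝ) * p k) (s * A) := by
    rw [← hasSum_nat_add_iff' 1]
    simpa using hs
  -- Markov's inequality: as `m ≥ 36 s`, at most 1/36 of the mass lies at or above `m`, which
  -- contradicts `h1`.
  have h2 : (m : ℝ) * (A - S) ≤ s * A := by
    have t1 := ((hasSum_nat_add_iff' m).2 hA).mul_left (m : ℝ)
    have t2 := (hasSum_nat_add_iff' m).2 hs'
    refine (hasSum_le (fun k => ?_) t1 t2).trans (sub_le_self _
      (Finset.sum_nonneg fun k _ => mul_nonneg (by positivity) (hp k)))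
    refine mul_le_mul_of_nonneg_right ?_ (hp _)
    push_cast
    linarith [(Nat.cast_nonneg k : (0 : ℝ) ≤ k)]
  have h3 : 4 * S < A := by nlinarith
  have h4 : 36 * s * (A - S) ≤ s * A := by
    refine le_trans (mul_le_mul_of_nonneg_right hms ?_) h2
    linarith
  nlinarith

/-! ### Fredholm determinant, its first minor, and the choice of the atoms. -/

section Selection

variable {H : Type*} [NormedAddCommGroup H] [InnerProductSpace ℂ H]
variable {X : Type*} [MeasurableSpace X] {μ : Measure X} [IsProbabilityMeasure μ] {e : X → H}

theorem summable_inv_pow_div_factorial (ε : ℝ) :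
    Summable fun k : ℕ => ε⁻¹ ^ k / (k.factorial : ℝ) :=
  Real.summable_pow_div_factorial _

theorem inv_pow_div_factorial_succ (ε : ℝ) (k : ℕ) :
    ((k : ℝ) + 1) * (ε⁻¹ ^ (k + 1) / ((k + 1).factorial : ℝ))
      = ε⁻¹ * (ε⁻¹ ^ k / (k.factorial : ℝ)) := by
  have h : ((k : ℝ) + 1) ≠ 0 := by positivity
  have h' : (k.factorial : ℝ) ≠ 0 := by positivity
  rw [Nat.factorial_succ]
  push_cast
  rw [pow_succ]
  field_simp

variable (μ e) in
/-- The Fredholm minor of the family `e` at `1 / ε`, as a sesquilinear form. -/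
def fredholmMinor (ε : ℝ) (u w : H) : ℂ :=
  ∑' k : ℕ, ((ε⁻¹ ^ k / (k.factorial : ℝ) : ℝ) : ℂ) * minorMean μ e k u w

variable (μ e) in
/-- The Fredholm determinant of the family `e` at `1 / ε`. -/
def fredholmDet (ε : ℝ) : ℝ := ∑' k : ℕ, ε⁻¹ ^ k / (k.factorial : ℝ) * gramMean μ e k

variable (he : StronglyMeasurable e) (hn : ∀ x, ‖e x‖ = 1) {ε : ℝ} (hε : 0 < ε)

include hn hε in
theorem norm_coeff_mul_minorMean_le (k : ℕ) (u w : H) :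
    ‖((ε⁻¹ ^ k / (k.factorial : ℝ) : ℝ) : ℂ) * minorMean μ e k u w‖
      ≤ ε⁻¹ ^ k / (k.factorial : ℝ) * (‖u‖ * ‖w‖) := by
  rw [norm_mul, Complex.norm_of_nonneg (by positivity)]
  exact mul_le_mul_of_nonneg_left (norm_minorMean_le hn k u w) (by positivity)

include hn hε in
theorem hasSum_fredholmMinor (u w : H) :
    HasSum (fun k : ℕ => ((ε⁻¹ ^ k / (k.factorial : ℝ) : ℝ) : ℂ) * minorMean μ e k u w)
      (fredholmMinor μ e ε u w) :=
  (Summable.of_norm_bounded ((summable_inv_pow_div_factorial ε).mul_right (‖u‖ * ‖w‖))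
    fun k => norm_coeff_mul_minorMean_le hn hε k u w).hasSum

include he hn hε

theorem hasSum_fredholmDet :
    HasSum (fun k : ℕ => ε⁻¹ ^ k / (k.factorial : ℝ) * gramMean μ e k) (fredholmDet μ e ε) := by
  refine (Summable.of_nonneg_of_le (fun k => ?_) (fun k => ?_)
    (summable_inv_pow_div_factorial ε)).hasSum
  · exact mul_nonneg (by positivity) (gramMean_nonneg k)
  · exact mul_le_of_le_one_right (by positivity) (gramMean_le_one he hn k)

theorem fredholmMinor_add_left (u u' w : H) :
    fredholmMinor μ e ε (u + u') w = fredholmMinor μ e ε u w + fredholmMinor μ e ε u' w := by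
  refine (hasSum_fredholmMinor hn hε _ w).unique ?_
  simpa only [minorMean_add_left he hn, mul_add] using
    (hasSum_fredholmMinor hn hε u w).add (hasSum_fredholmMinor hn hε u' w)

omit he in
theorem fredholmMinor_smul_left (c : ℂ) (u w : H) :
    fredholmMinor μ e ε (c • u) w = starRingEnd ℂ c * fredholmMinor μ e ε u w := by
  refine (hasSum_fredholmMinor hn hε _ w).unique ?_
  simpa only [minorMean_smul_left, mul_left_comm] using
    (hasSum_fredholmMinor hn hε u w).mul_left (starRingEnd ℂ c)

/-- Fredholm's identity for the first minor. -/
theorem fredholmMinor_add_apply {K : H →L[ℂ] H}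
    (hK : ∀ u w, ∫ x, ⟪u, e x⟫_ℂ * ⟪e x, w⟫_ℂ ∂μ = ⟪K u, w⟫_ℂ) (u w : H) :
    fredholmMinor μ e ε u w + (ε⁻¹ : ℝ) * fredholmMinor μ e ε (K u) w
      = ⟪u, w⟫_ℂ * fredholmDet μ e ε := by
  -- The recursion begins at index 1, so the index 0 terms are split off; both equal ⟪u, w⟫ and
  -- cancel at the end.
  have h1 := (hasSum_nat_add_iff' 1).2 (hasSum_fredholmMinor hn hε (μ := μ) u w)
  have h2 := (hasSum_fredholmMinor hn hε (μ := μ) (K u) w).mul_left ((ε⁻¹ : ℝ) : ℂ)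
  have h3 := (hasSum_nat_add_iff' 1).2
    ((Complex.hasSum_ofReal.2 (hasSum_fredholmDet (μ := μ) he hn hε)).mul_left ⟪u, w⟫_ℂ)
  have hterm : ∀ k : ℕ,
      ((ε⁻¹ ^ (k + 1) / ((k + 1).factorial : ℝ) : ℝ) : ℂ) * minorMean μ e (k + 1) u w
        + (ε⁻¹ : ℝ) * (((ε⁻¹ ^ k / (k.factorial : ℝ) : ℝ) : ℂ) * minorMean μ e k (K u) w)
      = ⟪u, w⟫_ℂ * (ε⁻¹ ^ (k + 1) / ((k + 1).factorial : ℝ) * gramMean μ e (k + 1) : ℝ) := by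
    intro k
    have h5 := minorMean_succ he hn hK k u w
    have h6 := congrArg (Complex.ofReal) (inv_pow_div_factorial_succ ε k)
    push_cast at h6 ⊢
    linear_combination ((ε : ℂ)⁻¹ ^ (k + 1) / ((k + 1).factorial : ℂ)) * h5
      - h6 * minorMean μ e k (K u) w
  have h4 := (h1.add h2).unique ((funext hterm).symm ▸ h3)
  simp only [Finset.sum_range_one, pow_zero, Nat.factorial_zero, minorMean_zero,
    gramMean_zero] at h4
  simp only [Nat.cast_one, div_one, Complex.ofReal_one, one_mul, mul_one] at h4
  linear_combination h4

/-- Since u = K (R u) + ε R u, additivity of the minor turns its value at `u` into `ε` times the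
left side of Fredholm's identity at `R u`. -/
theorem fredholmMinor_eq_mul_inner {K R : H →L[ℂ] H}
    (hK : ∀ u w, ∫ x, ⟪u, e x⟫_ℂ * ⟪e x, w⟫_ℂ ∂μ = ⟪K u, w⟫_ℂ)
    (hR : ∀ w, K (R w) + (ε : ℂ) • R w = w) (u w : H) :
    fredholmMinor μ e ε u w = ε * fredholmDet μ e ε * ⟪R u, w⟫_ℂ := by
  have h := fredholmMinor_add_apply he hn hε hK (R u) w
  have hε' : (ε : ℂ) ≠ 0 := by exact_mod_cast hε.ne'
  conv_lhs => rw [← hR u]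
  rw [fredholmMinor_add_left he hn hε, fredholmMinor_smul_left hn hε, Complex.conj_ofReal]
  push_cast at h
  field_simp at h
  linear_combination h

/-- The derivative of the logarithm of the Fredholm determinant is a trace. -/
theorem hasSum_gramMean_succ {K R : H →L[ℂ] H}
    (hK : ∀ u w, ∫ x, ⟪u, e x⟫_ℂ * ⟪e x, w⟫_ℂ ∂μ = ⟪K u, w⟫_ℂ)
    (hR : ∀ w, K (R w) + (ε : ℂ) • R w = w) {s : ℝ} (hs : ∫ x, ⟪R (e x), e x⟫_ℂ ∂μ = s) :
    HasSum (fun k : ℕ => ε⁻¹ ^ k / (k.factorial : ℝ) * gramMean μ e (k + 1))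
      (ε * (s * fredholmDet μ e ε)) := by
  have hint : ∀ k : ℕ, AEStronglyMeasurable (fun x => minorMean μ e k (e x) (e x)) μ := by
    intro k
    refine StronglyMeasurable.aestronglyMeasurable (StronglyMeasurable.integral_prod_right'
      (f := fun p : X × (Fin k → X) => borderedDet (e p.1) (e p.1) (fun i => e (p.2 i))) ?_)
    exact (measurable_borderedDet (he.comp_measurable measurable_fst)
      (he.comp_measurable measurable_fst)
      (fun i => he.comp_measurable ((measurable_pi_apply i).comp measurable_snd))).stronglyMeasurable
  have h := hasSum_integral_of_dominated_convergence (μ := μ)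
    (F := fun (k : ℕ) x => ((ε⁻¹ ^ k / (k.factorial : ℝ) : ℝ) : ℂ) * minorMean μ e k (e x) (e x))
    (f := fun x => fredholmMinor μ e ε (e x) (e x))
    (fun k _ => ε⁻¹ ^ k / (k.factorial : ℝ)) (fun k => (hint k).const_mul _)
    (fun k => Filter.Eventually.of_forall fun x => ?_)
    (Filter.Eventually.of_forall fun x => summable_inv_pow_div_factorial ε)
    (integrable_const _)
    (Filter.Eventually.of_forall fun x => hasSum_fredholmMinor hn hε _ _)
  · simp only [fredholmMinor_eq_mul_inner he hn hε hK hR, integral_const_mul,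
      integral_minorMean_self he hn, hs] at h
    rw [← Complex.hasSum_ofReal]
    rw [show ε * (s * fredholmDet μ e ε) = ε * fredholmDet μ e ε * s by ring]
    simpa only [Complex.ofReal_mul] using h
  · simpa [hn] using norm_coeff_mul_minorMean_le hn hε (μ := μ) k (e x) (e x)

/-- First moment method: the weight lemma fixes a size `k` whose mean residual is at most `4 ε s`,
and some tuple is no worse than the mean. -/
theorem exists_subset_integral_perpProj_le {K R : H →L[ℂ] H}
    (hK : ∀ u w, ∫ x, ⟪u, e x⟫_ℂ * ⟪e x, w⟫_ℂ ∂μ = ⟪K u, w⟫_ℂ)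
    (hR : ∀ w, K (R w) + (ε : ℂ) • R w = w) {s : ℝ} (hs : ∫ x, ⟪R (e x), e x⟫_ℂ ∂μ = s) :
    ∃ k ≤ ⌈36 * s⌉₊, ∃ z : Fin k → X, 0 < gramDet (fun i => e (z i)) ∧
      ∫ x, ‖perpProj (fun i => e (z i)) (e x)‖ ^ 2 ∂μ ≤ 4 * ε * s := by
  have hsum := (hasSum_gramMean_succ he hn hε hK hR hs).mul_left ε⁻¹
  rw [inv_mul_cancel_left₀ hε.ne'] at hsum
  have hterm : ∀ k : ℕ, ε⁻¹ * (ε⁻¹ ^ k / (k.factorial : ℝ) * gramMean μ e (k + 1))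
      = ((k : ℝ) + 1) * (ε⁻¹ ^ (k + 1) / ((k + 1).factorial : ℝ) * gramMean μ e (k + 1)) := by
    intro k
    rw [← mul_assoc, ← inv_pow_div_factorial_succ, mul_assoc]
  have hD := hasSum_fredholmDet (μ := μ) he hn hε
  have hnn : ∀ k : ℕ, 0 ≤ ε⁻¹ ^ k / (k.factorial : ℝ) * gramMean μ e k := fun k =>
    mul_nonneg (by positivity) (gramMean_nonneg k)
  have hD0 : 0 < fredholmDet μ e ε := by
    refine lt_of_lt_of_le one_pos ((le_of_eq ?_).trans (le_hasSum hD 0 fun k _ => hnn k))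
    simp [gramMean_zero]
  -- Unit vectors give `gramMean 1 = 1`, so the mean is positive and `⌈36 s⌉₊` is a legitimate
  -- positive cutoff.
  have hspos : 0 < s := by
    have h1 : gramMean μ e 1 = 1 := by
      rw [gramMean_succ he hn]
      simp [gramDet_zero, perpProj_zero, hn]
    have h2 := le_hasSum hsum 0 fun k _ =>
      (mul_nonneg (inv_nonneg.2 hε.le) (mul_nonneg (by positivity) (gramMean_nonneg (k + 1))))
    refine pos_of_mul_pos_left (lt_of_lt_of_le ?_ h2) hD0.le
    simp [h1, hε]
  simp only [hterm] at hsum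
  obtain ⟨k, hk, hpk, hle⟩ := exists_lt_succ_mul_le hnn (by simp [gramMean_zero]) hD hsum
    (Nat.ceil_pos.2 (by positivity : 0 < 36 * s)) (Nat.le_ceil _)
  refine ⟨k, hk.le, ?_⟩
  rw [← hterm] at hle
  have hck : 0 < ε⁻¹ ^ k / (k.factorial : ℝ) := by positivity
  have hG : 0 < gramMean μ e k := pos_of_mul_pos_right hpk hck.le
  have hle' : gramMean μ e (k + 1) ≤ 4 * ε * s * gramMean μ e k := by
    have h1 : (ε⁻¹ ^ k / (k.factorial : ℝ)) * gramMean μ e (k + 1)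
        ≤ (ε⁻¹ ^ k / (k.factorial : ℝ)) * (4 * ε * s * gramMean μ e k) := by
      have := mul_le_mul_of_nonneg_left hle hε.le
      rw [mul_inv_cancel_left₀ hε.ne'] at this
      linarith
    exact le_of_mul_le_mul_left h1 hck
  by_contra! hcon
  set P := Measure.pi fun _ : Fin k => μ
  have hi := integrable_gramDet_pi (μ := μ) he hn k
  have hi2 := (integrable_gramDet_mul_norm_sq (μ := μ) he hn k).integral_prod_right
  simp only [integral_const_mul] at hi2
  -- If every nondegenerate tuple failed, this nonnegative function would have integral at most 0
  -- and so vanish almost everywhere. The Gram determinant would then vanish almost everywhere,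
  -- against `hG`.
  have hzero : ∀ z : Fin k → X, 0 ≤ gramDet (fun i => e (z i)) *
      (∫ x, ‖perpProj (fun i => e (z i)) (e x)‖ ^ 2 ∂μ) - 4 * ε * s * gramDet fun i => e (z i) := by
    intro z
    rcases (gramDet_nonneg fun i => e (z i)).eq_or_lt with h | h
    · rw [← h]; simp
    · nlinarith [hcon z h]
  have hsub : ∫ z : Fin k → X, (gramDet (fun i => e (z i)) *
      (∫ x, ‖perpProj (fun i => e (z i)) (e x)‖ ^ 2 ∂μ) - 4 * ε * s * gramDet fun i => e (z i)) ∂P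
      ≤ 0 := by
    rw [integral_sub hi2 (hi.const_mul _), integral_const_mul, ← gramMean_succ he hn]
    exact sub_nonpos.2 hle'
  have hae := (integral_eq_zero_iff_of_nonneg hzero (hi2.sub (hi.const_mul _))).1
    (le_antisymm hsub (integral_nonneg hzero))
  have hG0 : gramMean μ e k = 0 := by
    rw [gramMean, ← integral_zero (Fin k → X) ℝ (μ := P)]
    refine integral_congr_ae ?_
    filter_upwards [hae] with z hz
    simp only [Pi.zero_apply] at hz
    by_contra hne
    have hpos := (gramDet_nonneg fun i => e (z i)).lt_of_ne' hne
    nlinarith [hcon z hpos]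
  exact hG.ne' hG0

end Selection

/-! ### Traces of weak integrals of rank-one operators, and Hilbert space tools. -/

theorem inner_self_eq_ofReal_norm_sq {E : Type*} [NormedAddCommGroup E] [InnerProductSpace ℂ E]
    (x : E) : ⟪x, x⟫_ℂ = ((‖x‖ ^ 2 : ℝ) : ℂ) := by
  rw [inner_self_eq_norm_sq_to_K]
  simp

section Trace

variable {H : Type u} [NormedAddCommGroup H] [InnerProductSpace ℂ H]

/-- Orthonormal vectors lie at distance √2, so balls of radius 1/2 about them are disjoint.
Countability permits dominated convergence over an arbitrary Hilbert basis. -/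
theorem _root_.Orthonormal.countable_of_separableSpace [TopologicalSpace.SeparableSpace H]
    {ι : Type*} {b : ι → H} (hb : Orthonormal ℂ b) : Countable ι := by
  have hd : ∀ i j, i ≠ j → ‖b i - b j‖ ^ 2 = 2 := by
    intro i j hij
    have h := norm_sub_sq (𝕜 := ℂ) (b i) (b j)
    rw [hb.1 i, hb.1 j, hb.2 hij] at h
    rw [h]
    norm_num
  refine Set.countable_univ_iff.1 (Set.PairwiseDisjoint.countable_of_isOpen
    (s := fun i => Metric.ball (b i) (1 / 2)) ?_ (fun i _ => Metric.isOpen_ball)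
    (fun i _ => ⟨b i, Metric.mem_ball_self (by norm_num)⟩))
  intro i _ j _ hij
  refine Metric.ball_disjoint_ball ?_
  rw [dist_eq_norm]
  nlinarith [hd i j hij, norm_nonneg (b i - b j)]

theorem _root_.HilbertBasis.hasSum_norm_inner_sq {ι : Type*} (b : HilbertBasis ι ℂ H) (x : H) :
    HasSum (fun i => ‖⟪b i, x⟫_ℂ‖ ^ 2) (‖x‖ ^ 2) := by
  rw [← Complex.hasSum_ofReal]
  have h := b.hasSum_inner_mul_inner x x
  have hterm : ∀ i, ⟪x, b i⟫_ℂ * ⟪b i, x⟫_ℂ = ((‖⟪b i, x⟫_ℂ‖ ^ 2 : ℝ) : ℂ) := fun i => by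
    rw [← inner_conj_symm x, Complex.conj_mul']
    simp
  simpa only [hterm, inner_self_eq_ofReal_norm_sq] using h

/-- The trace of an operator given by a weak integral of rank-one operators. -/
theorem hasTrace_of_inner_eq_integral [TopologicalSpace.SeparableSpace H] {X : Type*}
    [MeasurableSpace X] {μ : Measure X} [IsFiniteMeasure μ] {f g : X → H} {C : ℝ}
    (hf : StronglyMeasurable f) (hg : StronglyMeasurable g) (hfC : ∀ x, ‖f x‖ ≤ C)
    (hgC : ∀ x, ‖g x‖ ≤ C) {A : H →L[ℂ] H}
    (hA : ∀ w, ⟪w, A w⟫_ℂ = ∫ x, ⟪w, f x⟫_ℂ * ⟪g x, w⟫_ℂ ∂μ) :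
    HasTrace A (∫ x, ⟪g x, f x⟫_ℂ ∂μ) := by
  intro ι b
  have := b.orthonormal.countable_of_separableSpace
  simp only [hA]
  have hbd : ∀ x, HasSum (fun i => (‖⟪b i, f x⟫_ℂ‖ ^ 2 + ‖⟪b i, g x⟫_ℂ‖ ^ 2) / 2)
      ((‖f x‖ ^ 2 + ‖g x‖ ^ 2) / 2) := fun x =>
    ((b.hasSum_norm_inner_sq (f x)).add (b.hasSum_norm_inner_sq (g x))).div_const 2
  -- Termwise domination by the arithmetic-geometric mean inequality; by Parseval the dominating
  -- series sums to (‖f x‖² + ‖g x‖²) / 2, which is bounded.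
  refine hasSum_integral_of_dominated_convergence
    (fun i x => (‖⟪b i, f x⟫_ℂ‖ ^ 2 + ‖⟪b i, g x⟫_ℂ‖ ^ 2) / 2) (fun i => ?_)
    (fun i => Filter.Eventually.of_forall fun x => ?_)
    (Filter.Eventually.of_forall fun x => (hbd x).summable) ?_
    (Filter.Eventually.of_forall fun x => ?_)
  · exact ((stronglyMeasurable_const.inner hf).mul
      (hg.inner stronglyMeasurable_const)).aestronglyMeasurable
  · rw [norm_mul, norm_inner_symm (g x)]
    nlinarith [sq_nonneg (‖⟪b i, f x⟫_ℂ‖ - ‖⟪b i, g x⟫_ℂ‖)]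
  · simp only [(hbd _).tsum_eq]
    refine Integrable.of_bound (((hf.norm.pow 2).add (hg.norm.pow 2)).mul
      (stronglyMeasurable_const (b := (2 : ℝ)⁻¹))).aestronglyMeasurable (C ^ 2)
      (Filter.Eventually.of_forall fun x => ?_)
    rw [Real.norm_of_nonneg (by positivity)]
    have h1 := pow_le_pow_left₀ (norm_nonneg _) (hfC x) 2
    have h2 := pow_le_pow_left₀ (norm_nonneg _) (hgC x) 2
    linarith
  · simpa only [mul_comm] using b.hasSum_inner_mul_inner (g x) (f x)

theorem HasTrace.sub {A B : H →L[ℂ] H} {a b : ℂ} (hA : HasTrace A a) (hB : HasTrace B b) :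
    HasTrace (A - B) (a - b) := fun ι v => by
  simpa only [sub_apply, inner_sub_right] using (hA ι v).sub (hB ι v)

theorem HasTrace.opTrace_eq [CompleteSpace H] {A : H →L[ℂ] H} {τ : ℂ} (h : HasTrace A τ) :
    opTrace A = τ := by
  have hex : ∃ τ, HasTrace A τ := ⟨τ, h⟩
  obtain ⟨w, b, -⟩ := exists_hilbertBasis ℂ H
  rw [opTrace, dif_pos hex]
  exact (hex.choose_spec w b).unique (h w b)

end Trace

/-- A family of unit vectors with separately continuous Gram kernel is continuous. -/
theorem continuous_of_continuous_inner {H Y : Type*} [NormedAddCommGroup H]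
    [InnerProductSpace ℂ H] [TopologicalSpace Y] {f : Y → H} (hn : ∀ y, ‖f y‖ = 1)
    (hf : ∀ y, Continuous fun x => ⟪f x, f y⟫_ℂ) : Continuous f := by
  refine continuous_iff_continuousAt.2 fun y => ?_
  have h1 : ∀ x, ‖f x - f y‖ = √(2 - 2 * (⟪f x, f y⟫_ℂ).re) := fun x => by
    rw [eq_comm, Real.sqrt_eq_iff_eq_sq _ (norm_nonneg _)]
    · have h := norm_sub_sq (𝕜 := ℂ) (f x) (f y)
      rw [hn, hn] at h
      rw [h, RCLike.re_eq_complex_re]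
      ring
    · have h := (Complex.re_le_norm _).trans (norm_inner_le_norm (𝕜 := ℂ) (f x) (f y))
      rw [hn, hn] at h
      linarith
  refine tendsto_iff_norm_sub_tendsto_zero.2 ?_
  simp only [h1]
  have hc : Continuous fun x => √(2 - 2 * (⟪f x, f y⟫_ℂ).re) := by
    have := hf y
    fun_prop
  have h0 : √(2 - 2 * (⟪f y, f y⟫_ℂ).re) = 0 := by
    rw [← h1 y, sub_self, norm_zero]
  simpa only [h0] using hc.tendsto y

theorem _root_.MeasureTheory.L2.norm_sq_eq_integral {Y : Type*} [MeasurableSpace Y]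
    {ν : Measure Y} (f : Lp ℂ 2 ν) : ‖f‖ ^ 2 = ∫ y, ‖f y‖ ^ 2 ∂ν := by
  have h := L2.inner_def (𝕜 := ℂ) f f
  simp only [inner_self_eq_ofReal_norm_sq, integral_complex_ofReal] at h
  exact Complex.ofReal_injective h

/-! ### The atoms, the kernel operator and the statistical dimension. -/

section Fourier

variable (μ : Measure ℝ) [IsProbabilityMeasure μ] {T : ℝ}

instance : TopologicalSpace.SeparableSpace (L2T T) :=
  have : Fact ((2 : ℝ≥0∞) ≠ ∞) := ⟨ENNReal.ofNat_ne_top⟩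
  inferInstance

variable (T) in
/-- The representer `t ↦ e^{2 π i ξ t}` of the frequency functional at a real frequency. -/
def atom (ξ : ℝ) : L2T T := (memLp_conj_wave T ξ).toLp

theorem freqFunctional_eq_inner (ξ : ℝ) (f : L2T T) :
    freqFunctional T ξ f = ⟪atom T ξ, f⟫_ℂ := integral_mul_wave_eq_inner T ξ f

theorem coeFn_atom (ξ : ℝ) :
    atom T ξ =ᵐ[timeMeasure T] fun t => starRingEnd ℂ (wave ξ t) := MemLp.coeFn_toLp _

theorem norm_atom (hT : 0 < T) (ξ : ℝ) : ‖atom T ξ‖ = 1 := by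
  have := isProbabilityMeasure_timeMeasure hT
  have h : ‖atom T ξ‖ ^ 2 = 1 := by
    rw [L2.norm_sq_eq_integral]
    refine (integral_congr_ae (g := fun _ => (1 : ℝ)) ?_).trans (by simp)
    filter_upwards [coeFn_atom (T := T) ξ] with t ht
    rw [ht, RCLike.norm_conj, norm_wave_real, one_pow]
  exact (pow_eq_one_iff_of_nonneg (norm_nonneg _) two_ne_zero).1 h

/-- Continuity of the transform is weak continuity of the atoms; their constant norm upgrades it to
norm continuity. -/
theorem continuous_atom (hT : 0 < T) : Continuous (atom T) :=
  continuous_of_continuous_inner (norm_atom hT) fun η => by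
    simpa only [freqFunctional_eq_inner] using continuous_freqFunctional_real T (atom T η)

theorem coeFn_fourierOp (f : L2T T) : fourierOp μ T f =ᵐ[μ] fun ξ => ⟪atom T ξ, f⟫_ℂ := by
  filter_upwards [(memLp_freqFunctional μ T f).coeFn_toLp] with ξ hξ
  exact hξ.trans (freqFunctional_eq_inner ξ f)

/-- K is the weak integral of the rank-one projections onto the atoms; this supplies the hypothesis
`hK` above. -/
theorem integral_inner_atom_mul (u w : L2T T) :
    ∫ ξ, ⟪u, atom T ξ⟫_ℂ * ⟪atom T ξ, w⟫_ℂ ∂μ = ⟪kernelOp μ T u, w⟫_ℂ := by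
  rw [kernelOp, ContinuousLinearMap.comp_apply, ContinuousLinearMap.adjoint_inner_left,
    L2.inner_def]
  refine integral_congr_ae ?_
  filter_upwards [coeFn_fourierOp μ u, coeFn_fourierOp μ w] with ξ hu hw
  rw [hu, hw, RCLike.inner_apply, inner_conj_symm, mul_comm]

theorem inner_kernelOp_right (u w : L2T T) : ⟪u, kernelOp μ T w⟫_ℂ = ⟪kernelOp μ T u, w⟫_ℂ := by
  rw [kernelOp, ContinuousLinearMap.comp_apply, ContinuousLinearMap.comp_apply,
    ContinuousLinearMap.adjoint_inner_left, ContinuousLinearMap.adjoint_inner_right]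

theorem kernelOp_inverse_add {ε : ℝ} (hε : 0 < ε) (w : L2T T) :
    kernelOp μ T (Ring.inverse (kernelOp μ T + (ε : ℂ) • 1) w)
      + (ε : ℂ) • Ring.inverse (kernelOp μ T + (ε : ℂ) • 1) w = w :=
  congrArg (fun A : L2T T →L[ℂ] L2T T => A w)
    (Ring.mul_inverse_cancel _ (isUnit_kernelOp_add μ T hε))

/-- The ridge leverage score of the frequency `ξ`. -/
def leverage (T ε ξ : ℝ) : ℝ :=
  (⟪Ring.inverse (kernelOp μ T + (ε : ℂ) • 1) (atom T ξ), atom T ξ⟫_ℂ).re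

/-- Real because, with `y` the resolvent applied to the atom, the value is ‖F y‖² + ε ‖y‖². -/
theorem inner_inverse_eq_leverage {ε : ℝ} (hε : 0 < ε) (ξ : ℝ) :
    ⟪Ring.inverse (kernelOp μ T + (ε : ℂ) • 1) (atom T ξ), atom T ξ⟫_ℂ = leverage μ T ε ξ := by
  refine Complex.ext rfl ?_
  set y := Ring.inverse (kernelOp μ T + (ε : ℂ) • 1) (atom T ξ)
  have hy : kernelOp μ T y + (ε : ℂ) • y = atom T ξ := kernelOp_inverse_add μ hε _
  rw [← hy, inner_add_right, inner_smul_right, kernelOp, ContinuousLinearMap.comp_apply,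
    ContinuousLinearMap.adjoint_inner_right, inner_self_eq_ofReal_norm_sq,
    inner_self_eq_ofReal_norm_sq, ← Complex.ofReal_mul, ← Complex.ofReal_add]
  exact Complex.ofReal_im _

/-- With R the resolvent, KR is the weak integral of e (R* e)*, so its trace is the integral of ⟪R*
e, e⟫, the leverage. -/
theorem hasTrace_ridgeOp (hT : 0 < T) {ε : ℝ} (hε : 0 < ε) :
    HasTrace (ridgeOp μ T ε) ((∫ ξ, leverage μ T ε ξ ∂μ : ℝ) : ℂ) := by
  set R := Ring.inverse (kernelOp μ T + (ε : ℂ) • 1)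
  have hc := continuous_atom hT
  have h := hasTrace_of_inner_eq_integral (μ := μ) (f := atom T)
    (g := fun ξ => ContinuousLinearMap.adjoint R (atom T ξ))
    (C := max 1 ‖ContinuousLinearMap.adjoint R‖) hc.stronglyMeasurable
    ((ContinuousLinearMap.adjoint R).continuous.comp hc).stronglyMeasurable
    (fun ξ => (norm_atom hT ξ).le.trans (le_max_left _ _))
    (fun ξ => by
      refine (ContinuousLinearMap.le_opNorm _ _).trans ?_
      rw [norm_atom hT, mul_one]
      exact le_max_right _ _)
    (A := ridgeOp μ T ε) (fun w => by
      simp only [ContinuousLinearMap.adjoint_inner_left, integral_inner_atom_mul]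
      exact inner_kernelOp_right μ w (R w))
  refine (congrArg (HasTrace (ridgeOp μ T ε)) ?_).mp h
  rw [← integral_complex_ofReal]
  refine integral_congr_ae (Filter.Eventually.of_forall fun ξ => ?_)
  simp only [ContinuousLinearMap.adjoint_inner_left]
  rw [← inner_conj_symm, inner_inverse_eq_leverage μ hε, Complex.conj_ofReal]

theorem statDim_eq_integral_leverage (hT : 0 < T) {ε : ℝ} (hε : 0 < ε) :
    statDim μ T ε = ∫ ξ, leverage μ T ε ξ ∂μ := by
  rw [statDim, (hasTrace_ridgeOp μ hT hε).opTrace_eq, Complex.ofReal_re]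

end Fourier

/-! ### The residual operator, its trace, and the time average. -/

section Residual

variable (μ : Measure ℝ) [IsProbabilityMeasure μ] {T : ℝ} {s : ℕ} {z : Fin s → ℝ}

variable (T z) in
/-- The frequency subset operator at real frequencies. -/
abbrev realSubsetOp : L2T T →L[ℂ] EuclideanSpace ℂ (Fin s) := subsetOp T fun j => (z j : ℂ)

theorem realSubsetOp_apply (w : L2T T) (j : Fin s) :
    realSubsetOp T z w j = ⟪atom T (z j), w⟫_ℂ := freqFunctional_eq_inner (z j) w

theorem adjoint_realSubsetOp (c : EuclideanSpace ℂ (Fin s)) :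
    ContinuousLinearMap.adjoint (realSubsetOp T z) c = ∑ j, c j • atom T (z j) := by
  refine ext_inner_right ℂ fun w => ?_
  rw [ContinuousLinearMap.adjoint_inner_left, PiLp.inner_apply, sum_inner]
  refine Finset.sum_congr rfl fun j _ => ?_
  rw [realSubsetOp_apply, inner_smul_left, RCLike.inner_apply, mul_comm]

/-- In finite dimension injectivity suffices: CC*c = 0 forces C*c = 0, a linear relation among the
atoms. -/
theorem isUnit_subsetGram (hz : LinearIndependent ℂ fun j => atom T (z j)) :
    IsUnit (subsetGram T fun j => (z j : ℂ)) := by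
  rw [ContinuousLinearMap.isUnit_iff_isUnit_toLinearMap, LinearMap.isUnit_iff_ker_eq_bot,
    LinearMap.ker_eq_bot']
  intro c hc
  have h1 : ContinuousLinearMap.adjoint (realSubsetOp T z) c = 0 := by
    rw [← inner_self_eq_zero (𝕜 := ℂ), ContinuousLinearMap.adjoint_inner_left]
    have hc' : realSubsetOp T z (ContinuousLinearMap.adjoint (realSubsetOp T z) c) = 0 := hc
    rw [hc', inner_zero_right]
  rw [adjoint_realSubsetOp] at h1
  ext j
  exact Fintype.linearIndependent_iff.1 hz _ h1 j

variable (T z) in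
/-- The coefficients of the orthogonal projection onto the span of the atoms. -/
def projCoeff : L2T T →L[ℂ] EuclideanSpace ℂ (Fin s) :=
  (Ring.inverse (subsetGram T fun j => (z j : ℂ))).comp (realSubsetOp T z)

variable (T z) in
/-- The projection `C_s^* (C_s C_s^*)⁻¹ C_s`. -/
def atomProj : L2T T →L[ℂ] L2T T :=
  (ContinuousLinearMap.adjoint (realSubsetOp T z)).comp (projCoeff T z)

theorem atomProj_apply (w : L2T T) : atomProj T z w = ∑ j, projCoeff T z w j • atom T (z j) :=
  adjoint_realSubsetOp _

/-- The image lies in the span, and C annihilates the difference because CC* cancels its inverse;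
this characterises the orthogonal projection. -/
theorem perpProj_atom_eq (hz : LinearIndependent ℂ fun j => atom T (z j)) (w : L2T T) :
    perpProj (fun j => atom T (z j)) w = w - atomProj T z w := by
  rw [perpProj_apply]
  congr 1
  refine Submodule.eq_starProjection_of_mem_of_inner_eq_zero
    (K := Submodule.span ℂ (Set.range fun j => atom T (z j))) ?_ fun y hy => ?_
  · rw [atomProj_apply]
    exact Submodule.sum_mem _ fun j _ =>
      Submodule.smul_mem _ _ (Submodule.subset_span ⟨j, rfl⟩)
  · have hC : realSubsetOp T z (w - atomProj T z w) = 0 := by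
      have h := congrArg (fun A : EuclideanSpace ℂ (Fin s) →L[ℂ] EuclideanSpace ℂ (Fin s) =>
        A (realSubsetOp T z w)) (Ring.mul_inverse_cancel _ (isUnit_subsetGram hz))
      rw [map_sub, sub_eq_zero]
      exact h.symm
    induction hy using Submodule.span_induction with
    | mem x hx =>
      obtain ⟨j, rfl⟩ := hx
      rw [inner_eq_zero_symm, ← realSubsetOp_apply, hC]
      rfl
    | zero => exact inner_zero_right _
    | add x y _ _ hx hy => rw [inner_add_right, hx, hy, add_zero]
    | smul c x _ hx => rw [inner_smul_right, hx, mul_zero]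

theorem projOp_eq : projOp μ T (fun j => (z j : ℂ))
    = (projCoeff T z).comp (ContinuousLinearMap.adjoint (fourierOp μ T)) := rfl

theorem adjoint_projOp : ContinuousLinearMap.adjoint (projOp μ T (fun j => (z j : ℂ)))
    = (fourierOp μ T).comp (ContinuousLinearMap.adjoint (projCoeff T z)) := by
  rw [projOp_eq, ContinuousLinearMap.adjoint_comp, ContinuousLinearMap.adjoint_adjoint]

/-- C*Z = PF* and Z*C = FP*, so the subtracted term is PKP*. -/
theorem residualOp_eq : residualOp μ T (fun j => (z j : ℂ)) = kernelOp μ T -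
    (atomProj T z).comp ((kernelOp μ T).comp (ContinuousLinearMap.adjoint (atomProj T z))) := by
  rw [residualOp, adjoint_projOp, projOp_eq, atomProj, ContinuousLinearMap.adjoint_comp,
    ContinuousLinearMap.adjoint_adjoint, kernelOp]
  rfl

theorem hasTrace_residualOp (hT : 0 < T) (hz : LinearIndependent ℂ fun j => atom T (z j)) :
    HasTrace (residualOp μ T (fun j => (z j : ℂ)))
      ((∫ ξ, ‖perpProj (fun j => atom T (z j)) (atom T ξ)‖ ^ 2 ∂μ : ℝ) : ℂ) := by
  have hc := continuous_atom hT
  have hcP := (atomProj T z).continuous.comp hc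
  have h1 := hasTrace_of_inner_eq_integral (μ := μ) hc.stronglyMeasurable hc.stronglyMeasurable
    (fun ξ => (norm_atom hT ξ).le) (fun ξ => (norm_atom hT ξ).le) (A := kernelOp μ T) (fun w => by
      rw [integral_inner_atom_mul, inner_kernelOp_right])
  have hbd : ∀ ξ, ‖atomProj T z (atom T ξ)‖ ≤ ‖atomProj T z‖ := fun ξ => by
    simpa [norm_atom hT] using (atomProj T z).le_opNorm (atom T ξ)
  have h2 := hasTrace_of_inner_eq_integral (μ := μ) hcP.stronglyMeasurable hcP.stronglyMeasurable
    hbd hbd (A := (atomProj T z).comp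
      ((kernelOp μ T).comp (ContinuousLinearMap.adjoint (atomProj T z)))) (fun w => by
      have e1 : ∀ ξ, ⟪w, atomProj T z (atom T ξ)⟫_ℂ
          = ⟪ContinuousLinearMap.adjoint (atomProj T z) w, atom T ξ⟫_ℂ := fun ξ =>
        (ContinuousLinearMap.adjoint_inner_left _ _ _).symm
      have e2 : ∀ ξ, ⟪atomProj T z (atom T ξ), w⟫_ℂ
          = ⟪atom T ξ, ContinuousLinearMap.adjoint (atomProj T z) w⟫_ℂ := fun ξ =>
        (ContinuousLinearMap.adjoint_inner_right _ _ _).symm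
      simp only [Function.comp_apply, e1, e2]
      rw [integral_inner_atom_mul, ← inner_kernelOp_right,
        ContinuousLinearMap.adjoint_inner_left]
      rfl)
  rw [residualOp_eq]
  refine (congrArg (HasTrace _) ?_).mp (h1.sub h2)
  rw [← integral_complex_ofReal, ← integral_sub]
  · refine integral_congr_ae (Filter.Eventually.of_forall fun ξ => ?_)
    have h := inner_perpProj_self (fun j => atom T (z j)) (atom T ξ)
    -- Pythagoras: the two traces have densities ‖e‖² and ‖Pe‖², which differ by the squared
    -- residual.
    have h0 : ⟪atomProj T z (atom T ξ), perpProj (fun j => atom T (z j)) (atom T ξ)⟫_ℂ = 0 := by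
      rw [← sub_sub_cancel (atom T ξ) (atomProj T z (atom T ξ)), ← perpProj_atom_eq hz]
      exact Submodule.inner_right_of_mem_orthogonal (sub_perpProj_mem _ _) (perpProj_mem _ _)
    simp only [Function.comp_apply]
    rw [← h]
    rw [perpProj_atom_eq hz, inner_sub_right] at h0 ⊢
    have h3 := inner_conj_symm (𝕜 := ℂ) (atom T ξ) (atomProj T z (atom T ξ))
    have h4 := inner_conj_symm (𝕜 := ℂ) (atomProj T z (atom T ξ)) (atomProj T z (atom T ξ))
    rw [sub_eq_zero] at h0
    rw [h0, h4] at h3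
    rw [h3]
  · exact (integrable_const (1 : ℂ)).congr (Filter.Eventually.of_forall fun ξ => by
      simp [norm_atom hT])
  · refine Integrable.of_bound (hcP.inner hcP).stronglyMeasurable.aestronglyMeasurable
      (‖atomProj T z‖ * ‖atomProj T z‖) (Filter.Eventually.of_forall fun ξ => ?_)
    exact (norm_inner_le_norm _ _).trans (mul_le_mul (hbd ξ) (hbd ξ) (norm_nonneg _)
      (norm_nonneg _))

variable (T z) in
/-- The error at time `t` of the interpolated wave of frequency `ξ`. -/
def waveError (ξ t : ℝ) : ℂ :=
  wave ξ t - ∑ j, wave (z j) t * starRingEnd ℂ (projCoeff T z (atom T ξ) j)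

theorem continuous_waveError (hT : 0 < T) :
    Continuous fun p : ℝ × ℝ => waveError T z p.1 p.2 := by
  have h : Continuous fun p : ℝ × ℝ => projCoeff T z (atom T p.1) :=
    (projCoeff T z).continuous.comp ((continuous_atom hT).comp continuous_fst)
  have hj : ∀ j, Continuous fun p : ℝ × ℝ => projCoeff T z (atom T p.1) j := fun j =>
    (EuclideanSpace.proj (𝕜 := ℂ) j).continuous.comp h
  unfold waveError
  refine Continuous.sub (by unfold wave; fun_prop) (continuous_finsetSum _ fun j _ => ?_)
  exact Continuous.mul (by unfold wave; fun_prop) (Complex.continuous_conj.comp (hj j))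

theorem norm_waveError_le (hT : 0 < T) (ξ t : ℝ) :
    ‖waveError T z ξ t‖ ≤ 1 + s * ‖projCoeff T z‖ := by
  refine (norm_sub_le _ _).trans (add_le_add (norm_wave_real ξ t).le ?_)
  refine (norm_sum_le _ _).trans ((Finset.sum_le_card_nsmul _ _ ‖projCoeff T z‖
    fun j _ => ?_).trans (by simp))
  rw [norm_mul, norm_wave_real, one_mul, RCLike.norm_conj]
  refine (PiLp.norm_apply_le _ j).trans ?_
  simpa [norm_atom hT] using (projCoeff T z).le_opNorm (atom T ξ)

theorem integrable_norm_waveError_sq (hT : 0 < T) :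
    Integrable (fun p : ℝ × ℝ => ‖waveError T z p.1 p.2‖ ^ 2) (μ.prod (timeMeasure T)) :=
  Integrable.of_bound ((continuous_waveError hT).norm.pow 2).aestronglyMeasurable
    ((1 + s * ‖projCoeff T z‖) ^ 2) (Filter.Eventually.of_forall fun p => by
      rw [norm_pow, norm_norm]
      exact pow_le_pow_left₀ (norm_nonneg _) (norm_waveError_le hT p.1 p.2) 2)

/-- At fixed `t`, `waveError` as a function of `ξ` is φ_t - Z*φ_t. -/
theorem residualSq_eq_integral (t : ℝ) :
    residualSq μ T (fun j => (z j : ℂ)) t = ∫ ξ, ‖waveError T z ξ t‖ ^ 2 ∂μ := by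
  rw [residualSq, L2.norm_sq_eq_integral, adjoint_projOp]
  refine integral_congr_ae ?_
  set c := ContinuousLinearMap.adjoint (projCoeff T z) (phiVec (fun j => (z j : ℂ)) t)
  filter_upwards [Lp.coeFn_sub (phi μ t) (fourierOp μ T c), coeFn_fourierOp μ c,
    (memLp_wave μ t).coeFn_toLp] with ξ h1 h2 h3
  have h3' : phi μ t ξ = wave ξ t := h3
  rw [ContinuousLinearMap.comp_apply, h1, Pi.sub_apply, h2, h3',
    ContinuousLinearMap.adjoint_inner_right, PiLp.inner_apply]
  simp only [RCLike.inner_apply]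
  rfl

/-- At fixed `ξ`, the same `waveError` as a function of `t` is the conjugate of the residual of the
atom. -/
theorem norm_perpProj_atom_sq (hz : LinearIndependent ℂ fun j => atom T (z j)) (ξ : ℝ) :
    ‖perpProj (fun j => atom T (z j)) (atom T ξ)‖ ^ 2
      = ∫ t, ‖waveError T z ξ t‖ ^ 2 ∂(timeMeasure T) := by
  rw [perpProj_atom_eq hz, atomProj_apply, L2.norm_sq_eq_integral]
  refine integral_congr_ae ?_
  have hsum : (∑ j, projCoeff T z (atom T ξ) j • atom T (z j) : L2T T) =ᵐ[timeMeasure T]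
      fun t => ∑ j, projCoeff T z (atom T ξ) j * starRingEnd ℂ (wave (z j) t) := by
    have h1 := Lp.coeFn_finsetSum Finset.univ
      fun j => projCoeff T z (atom T ξ) j • atom T (z j)
    have h2 : ∀ᵐ t ∂(timeMeasure T), ∀ j, (projCoeff T z (atom T ξ) j • atom T (z j) : L2T T) t
        = projCoeff T z (atom T ξ) j * starRingEnd ℂ (wave (z j) t) := by
      refine ae_all_iff.2 fun j => ?_
      filter_upwards [Lp.coeFn_smul (projCoeff T z (atom T ξ) j) (atom T (z j)),
        coeFn_atom (T := T) (z j)] with t h3 h4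
      rw [h3, Pi.smul_apply, h4, smul_eq_mul]
    filter_upwards [h1, h2] with t h1 h2
    rw [h1]
    simp [h2]
  filter_upwards [Lp.coeFn_sub (atom T ξ) (∑ j, projCoeff T z (atom T ξ) j • atom T (z j)), hsum,
    coeFn_atom (T := T) ξ] with t h1 h2 h3
  rw [h1, Pi.sub_apply, h2, h3, waveError, ← RCLike.norm_conj]
  simp [mul_comm]

theorem integral_timeMeasure_real (hT : 0 < T) (f : ℝ → ℝ) :
    ∫ t, f t ∂(timeMeasure T) = 1 / T * ∫ t in (0 : ℝ)..T, f t := by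
  rw [timeMeasure, ProbabilityTheory.cond, integral_smul_measure,
    intervalIntegral.integral_of_le hT.le, integral_Icc_eq_integral_Ioc]
  simp [hT.le]

theorem intervalIntegrable_of_integrable_timeMeasure (hT : 0 < T) {f : ℝ → ℝ}
    (hf : Integrable f (timeMeasure T)) : IntervalIntegrable f volume 0 T := by
  rw [timeMeasure, ProbabilityTheory.cond, integrable_smul_measure (by simp) (by simp [hT])] at hf
  exact (intervalIntegrable_iff_integrableOn_Icc_of_le hT.le).2 hf

theorem intervalIntegrable_residualSq (hT : 0 < T) :
    IntervalIntegrable (residualSq μ T fun j => (z j : ℂ)) volume 0 T := by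
  refine intervalIntegrable_of_integrable_timeMeasure hT ?_
  exact (integrable_norm_waveError_sq μ hT).integral_prod_right.congr
    (Filter.Eventually.of_forall fun t => (residualSq_eq_integral μ t).symm)

/-- Both sides integrate |`waveError`|² over frequency and time, in opposite orders; Fubini applies.
-/
theorem integral_residualSq (hT : 0 < T) (hz : LinearIndependent ℂ fun j => atom T (z j)) :
    1 / T * ∫ t in (0 : ℝ)..T, residualSq μ T (fun j => (z j : ℂ)) t
      = ∫ ξ, ‖perpProj (fun j => atom T (z j)) (atom T ξ)‖ ^ 2 ∂μ := by
  rw [← integral_timeMeasure_real hT]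
  simp only [residualSq_eq_integral, norm_perpProj_atom_sq hz]
  rw [← integral_prod_symm _ (integrable_norm_waveError_sq μ hT),
    integral_prod _ (integrable_norm_waveError_sq μ hT)]

end Residual

end FourierSubset

end

/-! ### Assembly. -/

theorem mainTheorem7 (μ : Measure ℝ) [IsProbabilityMeasure μ] (T ε : ℝ) (hT : 0 < T)
    (hε : 0 < ε) :
    FourierSubset.HasTrace (FourierSubset.ridgeOp μ T ε) (FourierSubset.statDim μ T ε : ℂ) ∧
    ∃ s : ℕ, s ≤ ⌈36 * FourierSubset.statDim μ T ε⌉₊ ∧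
      ∃ ξ : Fin s → ℂ, Function.Injective ξ ∧ (∀ j, (ξ j).im = 0) ∧
        IsUnit (FourierSubset.subsetGram T ξ) ∧
        IntervalIntegrable (FourierSubset.residualSq μ T ξ) volume 0 T ∧
        ∃ τ : ℝ, FourierSubset.HasTrace (FourierSubset.residualOp μ T ξ) (τ : ℂ) ∧
          1 / T * ∫ t in (0 : ℝ)..T, FourierSubset.residualSq μ T ξ t = τ ∧
          τ ≤ 4 * ε * FourierSubset.statDim μ T ε := by
  have hs := FourierSubset.statDim_eq_integral_leverage μ hT hε
  refine ⟨hs ▸ FourierSubset.hasTrace_ridgeOp μ hT hε, ?_⟩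
  obtain ⟨s, hsle, z, hz, hle⟩ := FourierSubset.exists_subset_integral_perpProj_le (μ := μ)
    (FourierSubset.continuous_atom hT).stronglyMeasurable (FourierSubset.norm_atom hT) hε
    (FourierSubset.integral_inner_atom_mul μ) (FourierSubset.kernelOp_inverse_add μ hε)
    (s := FourierSubset.statDim μ T ε) (by
      simp only [FourierSubset.inner_inverse_eq_leverage μ hε, integral_complex_ofReal, hs])
  -- Independence of the atoms gives both the distinctness of the frequencies and the invertibility
  -- of CC*.
  have hli := FourierSubset.linearIndependent_of_gramDet_pos hz
  refine ⟨s, hsle, fun j => (z j : ℂ), fun i j hij => hli.injective ?_,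
    fun j => Complex.ofReal_im _, FourierSubset.isUnit_subsetGram hli,
    FourierSubset.intervalIntegrable_residualSq μ hT, _,
    FourierSubset.hasTrace_residualOp μ hT hli, FourierSubset.integral_residualSq μ hT hli, hle⟩
  simp only [Complex.ofReal_inj.1 hij]
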